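/- Let $d\in\mathbb N$, let $(\Omega,\mathcal F,\mathbb P)$ be a probability space, and let $H=H(p,x,\omega):\mathbb R^d\times\mathbb R^d\times\Omega\to\mathbb R$ be measurable in $\omega$ and satisfy the following. (A1) (Stationary ergodicity) There is a group $\{\tau_x\}_{x\in\mathbb R^d}$ of measurable, measure-preserving transformations of $\Omega$ with $\tau_{y+z}=\tau_y\circ\tau_z$ such that $H(p,y,\tau_z\omega)=H(p,y+z,\omega)$ for all $p,y,z,\omega$, and such that $\mathbb P[A]\in\{0,1\}$ for every $A\in\mathcal F$ with $\tau_z(A)=A$ for all $z$. (A2) (Coercivity) $\liminf_{|p|\to\infty}\operatorname{ess\,inf}_{(x,\omega)\in\mathbb R^d\times\Omega}|H(p,x,\omega)|=\infty$. (A3) (Continuity and boundedness) For every $\omega$ and every compact $K\subset\mathbb R^d$ there is a modulus of continuity $\rho$ with $|H(p,x,\omega)-H(q,y,\omega)|\le\rho(|p-q|+|x-y|)$ for all $p,q\in K$ and $x,y\in\mathbb R^d$; and $H$ is bounded on $K\times\mathbb R^d\times\Omega$ for every compact $K\subset\mathbb R^d$. Suppose that $H$ is regularly homogenizable at every $p\in\mathbb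 R^d$, with effective Hamiltonian $\overline H:\mathbb R^d\to\mathbb R$; that is, for every $p\in\mathbb R^d$, almost surely, the bounded continuous viscosity solutions $v_\lambda$, $\lambda>0$, of $$\lambda v_\lambda+H(p+Dv_\lambda,x,\omega)=0\quad\text{in }\mathbb R^d$$ satisfy $\lim_{\lambda\to0^+}\max_{|x|\le R/\lambda}|\lambda v_\lambda(x)+\overline H(p)|=0$ for every $R>0$. Let $u_0:\mathbb R^d\to\mathbb R$ be bounded and uniformly continuous. Solutions of the Cauchy problems below are understood as viscosity solutions that are continuous on $\mathbb R^d\times[0,\infty)$ and bounded on $\mathbb R^d\times[0,T]$ for every $T>0$. For $\varepsilon>0$ and almost every $\omega$ let $u^\varepsilon(\cdot,\cdot,\omega)$ be the viscosity solution of $$u^\varepsilon_t+H\!\left(Du^\varepsilon,\tfrac x\varepsilon,\omega\right)=0\ \text{ in }\mathbb R^d\times(0,\infty),\qquad u^\varepsilon(x,0,\omega)=u_0(x).$$ Then there are an event $\widetilde\Omega\in\mathcal F$ with $\mathbb P(\widetilde\Omega)=1$ and a deterministic function $\overline u:\mathbb R^d\times[0,\infty)\to\mathbb R$ such that, for every $\omega\in\widetilde\Omega$,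 $u^\varepsilon(\cdot,\cdot,\omega)\to\overline u$ locally uniformly in $\mathbb R^d\times(0,\infty)$ as $\varepsilon\to0^+$. Moreover, $\overline u$ is the unique viscosity solution of $$\overline u_t+\overline H(D\overline u)=0\ \text{ in }\mathbb R^d\times(0,\infty),\qquad \overline u(x,0)=u_0(x).$$ -/

import Mathlib

open Set Filter Topology MeasureTheory

/-- Euclidean space `ℝ^d`. -/
abbrev Rd (d : ℕ) : Type := EuclideanSpace ℝ (Fin d)

/-- Modulus of continuity: nondecreasing on `[0,∞)`, zero at `0`, and tending to `0` at `0+`. -/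
structure IsModulus (ρ : ℝ → ℝ) : Prop where
  mono : MonotoneOn ρ (Ici 0)
  zero : ρ 0 = 0
  tendsto : Tendsto ρ (𝓝[>] 0) (𝓝 0)

/-- Stationary ergodicity of the random field `H(p, x, ω)` with respect to some measure-preserving
group `τ` of transformations of `Ω` indexed by `ℝ^d`. -/
def IsStationaryErgodic {d : ℕ} {Ω : Type*} [MeasurableSpace Ω] (μ : Measure Ω)
    (H : Rd d → Rd d → Ω → ℝ) : Prop :=
  (∀ p x, Measurable (H p x)) ∧
  ∃ τ : Rd d → Ω → Ω,
    τ 0 = id ∧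
    (∀ y z, τ (y + z) = τ y ∘ τ z) ∧
    (∀ y, MeasurePreserving (τ y) μ μ) ∧
    (∀ p y z ω, H p y (τ z ω) = H p (y + z) ω) ∧
    (∀ A : Set Ω, MeasurableSet A → (∀ z, τ z '' A = A) → μ A = 0 ∨ μ A = 1)

/-- Coercivity: `liminf_{|p| → ∞} essinf_{(x,ω)} |H(p,x,ω)| = ∞`. -/
def IsCoerciveHamiltonian {d : ℕ} {Ω : Type*} [MeasurableSpace Ω] (μ : Measure Ω)
    (H : Rd d → Rd d → Ω → ℝ) : Prop :=
  liminf (fun p : Rd d =>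
    essInf (fun z : Rd d × Ω => ENNReal.ofReal |H p z.1 z.2|) ((volume : Measure (Rd d)).prod μ))
    (Bornology.cobounded (Rd d)) = ⊤

/-- For every `ω` and every compact `K`, a modulus of continuity for `H(·,·,ω)` on `K × ℝ^d`; and
for every compact `K`, boundedness of `H` on `K × ℝ^d × Ω`. -/
def IsContinuousBounded {d : ℕ} {Ω : Type*} (H : Rd d → Rd d → Ω → ℝ) : Prop :=
  (∀ ω, ∀ K : Set (Rd d), IsCompact K → ∃ ρ : ℝ → ℝ, IsModulus ρ ∧
    ∀ p ∈ K, ∀ q ∈ K, ∀ x y, |H p x ω - H q y ω| ≤ ρ (‖p - q‖ + ‖x - y‖)) ∧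
  (∀ K : Set (Rd d), IsCompact K → ∃ C : ℝ, ∀ p ∈ K, ∀ x ω, |H p x ω| ≤ C)

/-- `v` is a bounded continuous viscosity solution of `l v + H(p₀ + Dv, x) = 0` in `ℝ^d`. -/
structure IsAuxiliarySolution {d : ℕ} (H : Rd d → Rd d → ℝ) (l : ℝ) (p₀ : Rd d)
    (v : Rd d → ℝ) : Prop where
  continuous : Continuous v
  bounded : ∃ C : ℝ, ∀ x, |v x| ≤ C
  sub : ∀ (φ : Rd d → ℝ) (x : Rd d), ContDiff ℝ 1 φ → IsLocalMax (fun y => v y - φ y) x →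
    l * v x + H (p₀ + gradient φ x) x ≤ 0
  super : ∀ (φ : Rd d → ℝ) (x : Rd d), ContDiff ℝ 1 φ → IsLocalMin (fun y => v y - φ y) x →
    0 ≤ l * v x + H (p₀ + gradient φ x) x

/-- `H` is regularly homogenizable at `p₀`, with effective value `h`: almost surely the bounded
solutions `v_l`, `l > 0`, of the auxiliary problem satisfy `max_{|x| ≤ R/l} |l v_l(x) + h| → 0` as
`l → 0+`, for every `R > 0`. -/
def IsRegularlyHomogenizableAt {d : ℕ} {Ω : Type*} [MeasurableSpace Ω] (μ : Measure Ω)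
    (H : Rd d → Rd d → Ω → ℝ) (p₀ : Rd d) (h : ℝ) : Prop :=
  ∀ᵐ ω ∂μ, ∃ v : ℝ → Rd d → ℝ,
    (∀ l > 0, IsAuxiliarySolution (fun p x => H p x ω) l p₀ (v l)) ∧
    ∀ R > 0, ∀ δ > 0, ∀ᶠ l in 𝓝[>] (0 : ℝ), ∀ x, ‖x‖ ≤ R / l → |l * v l x + h| ≤ δ

/-- `u` is a viscosity solution of `u_t + H(Du, x) = 0` in `ℝ^d × (0,∞)` with `u(·,0) = u₀`, in the
class of continuous functions on `ℝ^d × [0,∞)` that are bounded on `ℝ^d × [0,T]` for each `T`.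
Only the values `u x t` with `t ≥ 0` matter. -/
structure IsCauchySolution {d : ℕ} (H : Rd d → Rd d → ℝ) (u₀ : Rd d → ℝ)
    (u : Rd d → ℝ → ℝ) : Prop where
  continuousOn : ContinuousOn (fun z : Rd d × ℝ => u z.1 z.2) (univ ×ˢ Ici 0)
  bounded : ∀ T : ℝ, ∃ C : ℝ, ∀ x, ∀ t ∈ Icc 0 T, |u x t| ≤ C
  initial : ∀ x, u x 0 = u₀ x
  sub : ∀ (φ : Rd d × ℝ → ℝ) (x : Rd d) (t : ℝ), 0 < t → ContDiff ℝ 1 φ →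
    IsLocalMax (fun z : Rd d × ℝ => u z.1 z.2 - φ z) (x, t) →
    deriv (fun s => φ (x, s)) t + H (gradient (fun y => φ (y, t)) x) x ≤ 0
  super : ∀ (φ : Rd d × ℝ → ℝ) (x : Rd d) (t : ℝ), 0 < t → ContDiff ℝ 1 φ →
    IsLocalMin (fun z : Rd d × ℝ => u z.1 z.2 - φ z) (x, t) →
    0 ≤ deriv (fun s => φ (x, s)) t + H (gradient (fun y => φ (y, t)) x) x

/-!
Rescaled correctors `V ε x = ε v_ε(x / ε)` solve `V + H(p + DV, x / ε) = 0` and tend to `-H̄(p)`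
locally uniformly, so adding them to a test function that touches the upper half-relaxed limit of
`u^ε` turns the equation for `u^ε` into one with `H̄`. The two viscosity inequalities are compared
by doubling variables. Since `|H|` is merely coercive, with no convexity and no a priori Lipschitz
bound, the gradients there need not be bounded; but beyond the radius where `|H|` is large it cannot
change sign, which is all that the comparison needs. This is used in the same way to prove that
`H̄` is continuous, so correctors at a countable dense set of slopes are enough, and a single event
of full probability serves all of them. The lower half-relaxed limit is treated by the duality
`u ↦ -u`, `H(p, x) ↦ -H(-p, x)`, and comparison for `H̄`, started from a modulus in time at `t = 0`
uniform in `ε`, makes the two limits coincide.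
-/

section Gradient

variable {E : Type*} [NormedAddCommGroup E] [InnerProductSpace ℝ E]

theorem contDiff_mul_norm_sub_sq (N : ℝ) (c : E) : ContDiff ℝ 1 fun y : E => N * ‖y - c‖ ^ 2 :=
  contDiff_const.mul ((contDiff_id.sub contDiff_const).norm_sq ℝ)

variable [CompleteSpace E]

theorem hasGradientAt_add {f g : E → ℝ} {a b x : E} (hf : HasGradientAt f a x)
    (hg : HasGradientAt g b x) : HasGradientAt (fun y => f y + g y) (a + b) x := by
  rw [hasGradientAt_iff_hasFDerivAt, map_add]
  exact hf.hasFDerivAt.add hg.hasFDerivAt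

theorem hasGradientAt_const_mul {f : E → ℝ} {a x : E} (c : ℝ) (hf : HasGradientAt f a x) :
    HasGradientAt (fun y => c * f y) (c • a) x := by
  rw [hasGradientAt_iff_hasFDerivAt, map_smul]
  exact hf.hasFDerivAt.const_mul c

theorem hasGradientAt_comp_smul {f : E → ℝ} {a : E} (c : ℝ) (x : E)
    (hf : HasGradientAt f a (c • x)) : HasGradientAt (fun y => f (c • y)) (c • a) x := by
  rw [hasGradientAt_iff_hasFDerivAt, map_smul]
  refine (hf.hasFDerivAt.comp x ((hasFDerivAt_id x).const_smul c)).congr_fderiv ?_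
  ext y
  simp

theorem hasGradientAt_norm_sub_sq (c x : E) :
    HasGradientAt (fun y => ‖y - c‖ ^ 2) ((2 : ℝ) • (x - c)) x := by
  rw [hasGradientAt_iff_hasFDerivAt]
  refine (((hasFDerivAt_id x).sub_const c).norm_sq).congr_fderiv ?_
  ext y
  simp [two_smul]

theorem hasGradientAt_mul_norm_sub_sq (N : ℝ) (c x : E) :
    HasGradientAt (fun y => N * ‖y - c‖ ^ 2) ((2 * N) • (x - c)) x := by
  simpa only [smul_smul, mul_comm N 2] using
    hasGradientAt_const_mul N (hasGradientAt_norm_sub_sq c x)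

theorem gradient_neg (f : E → ℝ) (x : E) : gradient (fun y => -f y) x = -gradient f x := by
  have : fderiv ℝ (fun y => -f y) x = -fderiv ℝ f x := fderiv_neg
  simp [gradient, this]

theorem hasDerivAt_mul_norm_sub_sq (N s t : ℝ) :
    HasDerivAt (fun r => N * ‖r - s‖ ^ 2) (2 * N * (t - s)) t := by
  simpa using (hasGradientAt_mul_norm_sub_sq N s t).hasDerivAt'

end Gradient

section SmoothDist

variable {E : Type*} [NormedAddCommGroup E]

/-- The smooth substitute `√(1 + ‖x - c‖²) - 1` for the distance from `c` to `x`. -/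
noncomputable def smoothDist (c x : E) : ℝ := √(1 + ‖x - c‖ ^ 2) - 1

theorem smoothDist_self (c : E) : smoothDist c c = 0 := by simp [smoothDist]

theorem smoothDist_nonneg (c x : E) : 0 ≤ smoothDist c x :=
  sub_nonneg.2 (Real.one_le_sqrt.2 (le_add_of_nonneg_right (sq_nonneg _)))

theorem norm_sub_one_le_smoothDist (c x : E) : ‖x - c‖ - 1 ≤ smoothDist c x :=
  sub_le_sub_right (Real.le_sqrt_of_sq_le (by linarith)) 1

theorem le_mul_smoothDist {K B : ℝ} (hK : 0 < K) {c x : E} (h : B / K + 1 ≤ ‖x - c‖) :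
    B ≤ K * smoothDist c x := by
  rw [← div_le_iff₀' hK]
  linarith [norm_sub_one_le_smoothDist c x]

variable [InnerProductSpace ℝ E]

theorem contDiff_smoothDist (c : E) : ContDiff ℝ 1 (smoothDist c) :=
  ((contDiff_const.add ((contDiff_id.sub contDiff_const).norm_sq ℝ)).sqrt
    fun x => by positivity).sub contDiff_const

theorem exists_hasGradientAt_smoothDist [CompleteSpace E] (c x : E) :
    ∃ e : E, ‖e‖ ≤ 1 ∧ HasGradientAt (smoothDist c) e x := by
  have hpos : 0 < √(1 + ‖x - c‖ ^ 2) := by positivity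
  refine ⟨(√(1 + ‖x - c‖ ^ 2))⁻¹ • (x - c), ?_, ?_⟩
  · rw [norm_smul, norm_inv, Real.norm_of_nonneg hpos.le, inv_mul_le_iff₀ hpos, mul_one]
    exact Real.le_sqrt_of_sq_le (by linarith)
  · have h := (((hasGradientAt_norm_sub_sq c x).hasFDerivAt.const_add 1).sqrt
      (by positivity)).sub_const 1
    rw [hasGradientAt_iff_hasFDerivAt]
    refine h.congr_fderiv ?_
    ext y
    simp
    field_simp

end SmoothDist

section TestFunctions

/-- The time derivative of a function of space and time. -/
noncomputable def timeDeriv {X : Type*} (φ : X × ℝ → ℝ) (z : X × ℝ) : ℝ :=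
  deriv (fun s => φ (z.1, s)) z.2

theorem timeDeriv_separable {X : Type*} (f : X → ℝ) (g : ℝ → ℝ) (z : X × ℝ) :
    timeDeriv (fun w => f w.1 + g w.2) z = deriv g z.2 := by
  simp only [timeDeriv, deriv_const_add']

section NormedSpace

variable {E : Type*} [NormedAddCommGroup E] [NormedSpace ℝ E]

theorem contDiff_separable {f : E → ℝ} {g : ℝ → ℝ} (hf : ContDiff ℝ 1 f) (hg : ContDiff ℝ 1 g) :
    ContDiff ℝ 1 fun w : E × ℝ => f w.1 + g w.2 :=
  (hf.comp contDiff_fst).add (hg.comp contDiff_snd)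

theorem timeDeriv_eq_fderiv {φ : E × ℝ → ℝ} {z : E × ℝ} (hφ : DifferentiableAt ℝ φ z) :
    timeDeriv φ z = fderiv ℝ φ z (0, 1) :=
  (hφ.hasFDerivAt.comp_hasDerivAt z.2
    ((hasDerivAt_const z.2 z.1).prodMk (hasDerivAt_id z.2))).deriv

theorem timeDeriv_add {φ χ : E × ℝ → ℝ} {z : E × ℝ} (hφ : DifferentiableAt ℝ φ z)
    (hχ : DifferentiableAt ℝ χ z) :
    timeDeriv (fun w => φ w + χ w) z = timeDeriv φ z + timeDeriv χ z := by
  rw [timeDeriv_eq_fderiv hφ, timeDeriv_eq_fderiv hχ, timeDeriv_eq_fderiv (hφ.fun_add hχ),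
    fderiv_fun_add hφ hχ]
  rfl

theorem continuous_timeDeriv {φ : E × ℝ → ℝ} (hφ : ContDiff ℝ 1 φ) :
    Continuous (timeDeriv φ) := by
  rw [show timeDeriv φ = fun z => fderiv ℝ φ z (0, 1) from
    funext fun z => timeDeriv_eq_fderiv (hφ.differentiable one_ne_zero z)]
  exact (hφ.continuous_fderiv one_ne_zero).clm_apply continuous_const

end NormedSpace

variable {E : Type*} [NormedAddCommGroup E] [InnerProductSpace ℝ E] [CompleteSpace E]

/-- The spatial gradient of a function of space and time. -/
noncomputable def spaceGrad (φ : E × ℝ → ℝ) (z : E × ℝ) : E := gradient (fun y => φ (y, z.2)) z.1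

theorem spaceGrad_separable (f : E → ℝ) (g : ℝ → ℝ) (z : E × ℝ) :
    spaceGrad (fun w => f w.1 + g w.2) z = gradient f z.1 := by
  simp only [spaceGrad, gradient, fderiv_add_const]

theorem spaceGrad_eq_fderiv {φ : E × ℝ → ℝ} {z : E × ℝ} (hφ : DifferentiableAt ℝ φ z) :
    spaceGrad φ z = (InnerProductSpace.toDual ℝ E).symm
      ((fderiv ℝ φ z).comp (ContinuousLinearMap.inl ℝ E ℝ)) :=
  congrArg _ (hφ.hasFDerivAt.comp z.1 (hasFDerivAt_prodMk_left z.1 z.2)).fderiv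

theorem spaceGrad_add {φ χ : E × ℝ → ℝ} {z : E × ℝ} (hφ : DifferentiableAt ℝ φ z)
    (hχ : DifferentiableAt ℝ χ z) :
    spaceGrad (fun w => φ w + χ w) z = spaceGrad φ z + spaceGrad χ z := by
  rw [spaceGrad_eq_fderiv hφ, spaceGrad_eq_fderiv hχ, spaceGrad_eq_fderiv (hφ.fun_add hχ),
    fderiv_fun_add hφ hχ, ContinuousLinearMap.add_comp, map_add]

theorem continuous_spaceGrad {φ : E × ℝ → ℝ} (hφ : ContDiff ℝ 1 φ) :
    Continuous (spaceGrad φ) := by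
  rw [show spaceGrad φ = fun z => (InnerProductSpace.toDual ℝ E).symm
      ((fderiv ℝ φ z).comp (ContinuousLinearMap.inl ℝ E ℝ)) from
    funext fun z => spaceGrad_eq_fderiv (hφ.differentiable one_ne_zero z)]
  exact (LinearIsometryEquiv.continuous _).comp
    ((hφ.continuous_fderiv one_ne_zero).clm_comp continuous_const)

end TestFunctions

section Viscosity

variable {E : Type*} [NormedAddCommGroup E] [InnerProductSpace ℝ E] [CompleteSpace E]

/-- `U` is a viscosity subsolution of `U_t + G(DU, x) ≤ 0` at the points of the set `s`. No
semicontinuity of `U` is included. -/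
def IsViscositySubOn (G : E → E → ℝ) (s : Set (E × ℝ)) (U : E × ℝ → ℝ) : Prop :=
  ∀ (φ : E × ℝ → ℝ) (z : E × ℝ), z ∈ s → ContDiff ℝ 1 φ → IsLocalMax (fun w => U w - φ w) z →
    timeDeriv φ z + G (spaceGrad φ z) z.1 ≤ 0

theorem IsViscositySubOn.deriv_add_le_zero {G : E → E → ℝ} {s : Set (E × ℝ)} {U : E × ℝ → ℝ}
    (h : IsViscositySubOn G s U) {f : E → ℝ} {g : ℝ → ℝ} (hf : ContDiff ℝ 1 f)
    (hg : ContDiff ℝ 1 g) {z : E × ℝ} (hz : z ∈ s)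
    (hmax : IsLocalMax (fun w => U w - (f w.1 + g w.2)) z) :
    deriv g z.2 + G (gradient f z.1) z.1 ≤ 0 := by
  simpa only [timeDeriv_separable, spaceGrad_separable] using
    h _ z hz (contDiff_separable hf hg) hmax

/-- It suffices to test with functions that touch quadratically from above: subtracting the square
of a smooth distance to the contact point changes neither derivative there. -/
theorem isViscositySubOn_of_strict {G : E → E → ℝ} {s : Set (E × ℝ)} {U : E × ℝ → ℝ}
    (h : ∀ (φ : E × ℝ → ℝ) (z : E × ℝ), z ∈ s → ContDiff ℝ 1 φ →
      (∀ᶠ w in 𝓝 z, U w - φ w + dist w z ^ 2 ≤ U z - φ z) →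
      timeDeriv φ z + G (spaceGrad φ z) z.1 ≤ 0) : IsViscositySubOn G s U := by
  intro φ z hz hφ hmax
  have hf := contDiff_mul_norm_sub_sq 1 z.1
  have hg := contDiff_mul_norm_sub_sq 1 z.2
  have hχ := contDiff_separable hf hg
  have hd := hφ.differentiable one_ne_zero z
  have hdχ := hχ.differentiable one_ne_zero z
  have ht : timeDeriv (fun w : E × ℝ => 1 * ‖w.1 - z.1‖ ^ 2 + 1 * ‖w.2 - z.2‖ ^ 2) z = 0 := by
    rw [timeDeriv_separable (fun y => 1 * ‖y - z.1‖ ^ 2) (fun r => 1 * ‖r - z.2‖ ^ 2)]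
    rw [(hasDerivAt_mul_norm_sub_sq 1 z.2 z.2).deriv, sub_self, mul_zero]
  have hx : spaceGrad (fun w : E × ℝ => 1 * ‖w.1 - z.1‖ ^ 2 + 1 * ‖w.2 - z.2‖ ^ 2) z = 0 := by
    rw [spaceGrad_separable (fun y => 1 * ‖y - z.1‖ ^ 2) (fun r => 1 * ‖r - z.2‖ ^ 2),
      (hasGradientAt_mul_norm_sub_sq 1 z.1 z.1).gradient, sub_self, smul_zero]
  have key := h _ z hz (hφ.add hχ) ?_
  · rwa [timeDeriv_add hd hdχ, spaceGrad_add hd hdχ, ht, hx, add_zero, add_zero] at key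
  filter_upwards [hmax] with w hw
  have hdist : dist w z ^ 2 ≤ ‖w.1 - z.1‖ ^ 2 + ‖w.2 - z.2‖ ^ 2 := by
    rw [Prod.dist_eq, dist_eq_norm, dist_eq_norm]
    rcases max_choice ‖w.1 - z.1‖ ‖w.2 - z.2‖ with hm | hm <;> rw [hm] <;> nlinarith
  simp only [sub_self, norm_zero]
  linarith

end Viscosity

section Duality

variable {d : ℕ}

/-- The Hamiltonian of the equation solved by `-u` when `u` solves the equation of `H`. -/
def dualHam {E X : Type*} [Neg E] (H : E → X → ℝ) : E → X → ℝ := fun p x => -H (-p) x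

theorem isLocalMin_sub_neg {X : Type*} [TopologicalSpace X] {f g : X → ℝ} {a : X}
    (h : IsLocalMax (fun y => -f y - g y) a) : IsLocalMin (fun y => f y - -g y) a :=
  h.neg.congr (Eventually.of_forall fun y => by simp only; ring)

theorem isLocalMax_sub_neg {X : Type*} [TopologicalSpace X] {f g : X → ℝ} {a : X}
    (h : IsLocalMin (fun y => -f y - g y) a) : IsLocalMax (fun y => f y - -g y) a :=
  h.neg.congr (Eventually.of_forall fun y => by simp only; ring)

theorem IsAuxiliarySolution.dual {H : Rd d → Rd d → ℝ} {l : ℝ} {p : Rd d} {v : Rd d → ℝ}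
    (h : IsAuxiliarySolution H l p v) :
    IsAuxiliarySolution (dualHam H) l (-p) (fun x => -v x) where
  continuous := h.continuous.neg
  bounded := by simpa only [abs_neg] using h.bounded
  sub φ x hφ hm := by
    have := h.super (fun y => -φ y) x hφ.neg (isLocalMin_sub_neg hm)
    rw [gradient_neg] at this
    simp only [dualHam, neg_add, neg_neg]
    linarith
  super φ x hφ hm := by
    have := h.sub (fun y => -φ y) x hφ.neg (isLocalMax_sub_neg hm)
    rw [gradient_neg] at this
    simp only [dualHam, neg_add, neg_neg]
    linarith

theorem IsCauchySolution.dual {H : Rd d → Rd d → ℝ} {u₀ : Rd d → ℝ} {u : Rd d → ℝ → ℝ}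
    (h : IsCauchySolution H u₀ u) :
    IsCauchySolution (dualHam H) (fun x => -u₀ x) (fun x t => -u x t) where
  continuousOn := h.continuousOn.neg
  bounded := by simpa only [abs_neg] using h.bounded
  initial x := congrArg _ (h.initial x)
  sub φ x t ht hφ hm := by
    have := h.super (fun y => -φ y) x t ht hφ.neg (isLocalMin_sub_neg hm)
    rw [gradient_neg, deriv.fun_neg] at this
    simp only [dualHam]
    linarith
  super φ x t ht hφ hm := by
    have := h.sub (fun y => -φ y) x t ht hφ.neg (isLocalMax_sub_neg hm)
    rw [gradient_neg, deriv.fun_neg] at this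
    simp only [dualHam]
    linarith

theorem IsCauchySolution.isViscositySubOn {H : Rd d → Rd d → ℝ} {u₀ : Rd d → ℝ}
    {u : Rd d → ℝ → ℝ} (h : IsCauchySolution H u₀ u) :
    IsViscositySubOn H (univ ×ˢ Ioi 0) (fun z => u z.1 z.2) :=
  fun φ z hz hφ hm => h.sub φ z.1 z.2 hz.2 hφ hm

end Duality

section Doubling

theorem exists_quadratic_penalty (B : ℝ) {δ : ℝ} (hδ : 0 < δ) :
    ∃ N > 0, ∀ a, N * a ^ 2 ≤ B → |a| ≤ δ := by
  refine ⟨(|B| + 1) / δ ^ 2, by positivity, fun a ha => abs_le_of_sq_le_sq ?_ hδ.le⟩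
  have hN : (|B| + 1) / δ ^ 2 * δ ^ 2 = |B| + 1 := by field_simp
  refine le_of_mul_le_mul_left (a := (|B| + 1) / δ ^ 2) ?_ (by positivity)
  linarith [le_abs_self B]

theorem exists_isLocalMax_doubling {X Y : Type*} [TopologicalSpace X] [TopologicalSpace Y]
    {K : Set X} {L : Set Y} (hK : IsCompact K) (hL : IsCompact L) {f : X → ℝ} {g : Y → ℝ}
    {D : X → Y → ℝ} (hf : UpperSemicontinuousOn f K) (hg : UpperSemicontinuousOn g L)
    (hD : Continuous fun Z : X × Y => D Z.1 Z.2) {x₁ : X} {y₁ : Y} (hx₁ : x₁ ∈ K) (hy₁ : y₁ ∈ L) :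
    ∃ x ∈ K, ∃ y ∈ L, f x₁ + g y₁ - D x₁ y₁ ≤ f x + g y - D x y ∧
      (K ∈ 𝓝 x → IsLocalMax (fun x' => f x' - D x' y) x) ∧
      (L ∈ 𝓝 y → IsLocalMax (fun y' => g y' - D x y') y) := by
  have husc : UpperSemicontinuousOn (fun Z : X × Y => f Z.1 + g Z.2 + -D Z.1 Z.2) (K ×ˢ L) :=
    ((hf.comp continuousOn_fst fun Z hZ => hZ.1).add
      (hg.comp continuousOn_snd fun Z hZ => hZ.2)).add hD.neg.continuousOn.upperSemicontinuousOn
  obtain ⟨⟨x, y⟩, ⟨hx, hy⟩, hmax⟩ :=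
    husc.exists_isMaxOn ⟨(x₁, y₁), mk_mem_prod hx₁ hy₁⟩ (hK.prod hL)
  have hle : ∀ x' ∈ K, ∀ y' ∈ L, f x' + g y' - D x' y' ≤ f x + g y - D x y :=
    fun x' hx' y' hy' => hmax (mk_mem_prod hx' hy')
  refine ⟨x, hx, y, hy, hle x₁ hx₁ y₁ hy₁, fun hn => ?_, fun hn => ?_⟩
  · filter_upwards [hn] with x' hx'
    linarith [hle x' hx' y hy]
  · filter_upwards [hn] with y' hy'
    linarith [hle x hx y' hy']

theorem exists_isLocalMax_isLocalMin_doubling {X E : Type*} [PseudoMetricSpace X] [ProperSpace X]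
    [NormedAddCommGroup E] [ProperSpace E] {π : X → E} (hπ : LipschitzWith 1 π) {f : X → ℝ}
    {g : E → ℝ} {z₀ z₁ : X} {r c gap tol : ℝ}
    (hf : UpperSemicontinuousOn f (Metric.closedBall z₀ r))
    (hg : ContinuousOn g (Metric.closedBall (π z₀) (2 * r)))
    (hosc : ∀ y ∈ Metric.closedBall (π z₀) (2 * r), ∀ y' ∈ Metric.closedBall (π z₀) (2 * r),
      g y - g y' < gap)
    (hsph : ∀ z ∈ Metric.sphere z₀ r, f z ≤ c - gap) (hz₁ : z₁ ∈ Metric.ball z₀ r)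
    (hcen : c ≤ f z₁) (htol : 0 < tol) :
    ∃ N : ℝ, ∃ z ∈ Metric.ball z₀ r, ∃ y ∈ Metric.ball (π z₀) (2 * r), ‖π z - y‖ ≤ tol ∧
      IsLocalMax (fun w => f w - N * ‖π w - y‖ ^ 2) z ∧
      IsLocalMin (fun w => g w + N * ‖w - π z‖ ^ 2) y := by
  have hr : 0 < r := Metric.pos_of_mem_ball hz₁
  have hdist : ∀ z, dist (π z) (π z₀) ≤ dist z z₀ := fun z => by simpa using hπ.dist_le_mul z z₀
  have hπz₁ : π z₁ ∈ Metric.closedBall (π z₀) (2 * r) :=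
    (hdist z₁).trans (by linarith [Metric.mem_ball.1 hz₁])
  obtain ⟨B, hB⟩ := hf.bddAbove_of_isCompact (isCompact_closedBall z₀ r)
  set τ := min tol (r / 2)
  have hτ : 0 < τ := lt_min htol (half_pos hr)
  obtain ⟨N, hN, hNτ⟩ := exists_quadratic_penalty (B - c + gap) hτ
  obtain ⟨z, hz, y, hy, hval, hmax, hmin⟩ := exists_isLocalMax_doubling
    (D := fun w y => N * ‖π w - y‖ ^ 2) (isCompact_closedBall z₀ r)
    (isCompact_closedBall (π z₀) (2 * r)) hf hg.neg.upperSemicontinuousOn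
    (by have := hπ.continuous; fun_prop) (Metric.ball_subset_closedBall hz₁) hπz₁
  simp only [sub_self, norm_zero, Pi.neg_apply] at hval
  have hg_osc := hosc _ hπz₁ y hy
  have hzy : ‖π z - y‖ ≤ τ :=
    (le_abs_self _).trans (hNτ _ (by linarith [hB ⟨z, hz, rfl⟩]))
  have hzb : z ∈ Metric.ball z₀ r := lt_of_le_of_ne hz fun hzs => by
    have : 0 ≤ N * ‖π z - y‖ ^ 2 := by positivity
    linarith [hsph z hzs]
  have hyb : y ∈ Metric.ball (π z₀) (2 * r) := by
    rw [Metric.mem_ball]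
    linarith [dist_triangle_left y (π z₀) (π z), dist_eq_norm (π z) y, hdist z,
      Metric.mem_ball.1 hzb, min_le_right tol (r / 2)]
  refine ⟨N, z, hzb, y, hyb, hzy.trans (min_le_left _ _),
    hmax (Metric.closedBall_mem_nhds_of_mem hzb), ?_⟩
  refine (hmin (Metric.closedBall_mem_nhds_of_mem hyb)).neg.congr (Eventually.of_forall fun w => ?_)
  simp only [Pi.neg_apply, norm_sub_rev (π z) w]
  ring

end Doubling

section Comparison

theorem exists_timePenalty (T B : ℝ) {η : ℝ} (hη : 0 < η) :
    ∃ g : ℝ → ℝ, ∃ κ > 0, ContDiff ℝ 1 g ∧ (∀ t, 0 < g t) ∧ g T = η ∧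
      (∀ t, T + 1 / 2 ≤ t → B < g t) ∧ ∀ t, 0 ≤ t → κ ≤ deriv g t := by
  obtain ⟨n, hn, hnB⟩ : ∃ n > 0, B < η * (n * (1 / 2) + 1) :=
    ⟨2 * (|B| / η) + 1, by positivity, by
      have : η * ((2 * (|B| / η) + 1) * (1 / 2) + 1) = |B| + 3 / 2 * η := by field_simp; ring
      linarith [le_abs_self B]⟩
  have hderiv : ∀ t, HasDerivAt (fun s => η * Real.exp (n * (s - T)))
      (η * (Real.exp (n * (t - T)) * n)) t := fun t => by
    simpa using ((((hasDerivAt_id t).sub_const T).const_mul n).exp).const_mul η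
  refine ⟨fun t => η * Real.exp (n * (t - T)), η * (Real.exp (n * (0 - T)) * n), by positivity,
    by fun_prop, fun t => by positivity, by simp, fun t ht => hnB.trans_le ?_, fun t ht => ?_⟩
  · have : n * (1 / 2) ≤ n * (t - T) := by gcongr; linarith
    refine mul_le_mul_of_nonneg_left ?_ hη.le
    linarith [Real.add_one_le_exp (n * (t - T))]
  · rw [(hderiv t).deriv]
    gcongr

theorem exists_isLocalMax_sub_time {E : Type*} [NormedAddCommGroup E] [ProperSpace E]
    {V : E × ℝ → ℝ} (hV : UpperSemicontinuousOn V (univ ×ˢ Ici 0)) (hinit : ∀ x, V (x, 0) ≤ 0)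
    (hfar : ∀ T, ∃ R, ∀ x, ∀ t ∈ Icc 0 T, R ≤ ‖x‖ → V (x, t) ≤ 0) {z : E × ℝ} (hz : 0 ≤ z.2)
    (hpos : 0 < V z) :
    ∃ g : ℝ → ℝ, ∃ w : E × ℝ, ContDiff ℝ 1 g ∧ 0 < w.2 ∧ 0 < deriv g w.2 ∧
      IsLocalMax (fun w => V w - g w.2) w := by
  obtain ⟨R, hR⟩ := hfar (z.2 + 1)
  set S := Metric.closedBall (0 : E) (max R ‖z.1‖) ×ˢ Icc 0 (z.2 + 1)
  have hS : IsCompact S := (isCompact_closedBall _ _).prod isCompact_Icc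
  have hzS : z ∈ S := ⟨by simp, hz, by linarith⟩
  have husc : UpperSemicontinuousOn V S := hV.mono fun w hw => ⟨trivial, hw.2.1⟩
  obtain ⟨B, hB⟩ := husc.bddAbove_of_isCompact hS
  obtain ⟨g, κ, hκ, hg, hg0, hgz, hgB, hgκ⟩ := exists_timePenalty z.2 B (half_pos hpos)
  obtain ⟨⟨x, t⟩, hxt, hmax⟩ := (husc.add (hg.continuous.comp
    continuous_snd).neg.continuousOn.upperSemicontinuousOn).exists_isMaxOn ⟨z, hzS⟩ hS
  have hval : 0 < V (x, t) - g t := by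
    have : V z + -g z.2 ≤ V (x, t) + -g t := hmax hzS
    linarith
  have hxR : dist x 0 < max R ‖z.1‖ := lt_of_le_of_ne hxt.1 fun h => by
    rw [dist_zero_right] at h
    linarith [hR x t hxt.2 (h ▸ le_max_left _ _), hg0 t]
  have ht0 : 0 < t := lt_of_le_of_ne hxt.2.1 fun h => by
    subst h
    linarith [hinit x, hg0 0]
  have ht1 : t < z.2 + 1 := by
    by_contra! h
    linarith [hgB t (by linarith), hB ⟨_, hxt, rfl⟩]
  exact ⟨g, (x, t), hg, ht0, hκ.trans_le (hgκ t ht0.le), (hmax.isLocalMax (prod_mem_nhds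
    (Metric.closedBall_mem_nhds_of_mem hxR) (Icc_mem_nhds ht0 ht1))).congr
      (Eventually.of_forall fun w => (sub_eq_add_neg _ _).symm)⟩

variable {E : Type*} [NormedAddCommGroup E] [InnerProductSpace ℝ E]

theorem IsViscositySubOn.le_of_classical_supersolution [ProperSpace E] {G : E → E → ℝ}
    {U ψ : E × ℝ → ℝ} (hU : UpperSemicontinuousOn U (univ ×ˢ Ici 0))
    (hsub : IsViscositySubOn G (univ ×ˢ Ioi 0) U) (hψ : ContDiff ℝ 1 ψ)
    (hsuper : ∀ z, 0 < z.2 → 0 ≤ timeDeriv ψ z + G (spaceGrad ψ z) z.1)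
    (hinit : ∀ x, U (x, 0) ≤ ψ (x, 0))
    (hfar : ∀ T, ∃ R, ∀ x, ∀ t ∈ Icc 0 T, R ≤ ‖x‖ → U (x, t) ≤ ψ (x, t))
    {z : E × ℝ} (hz : 0 ≤ z.2) : U z ≤ ψ z := by
  by_contra! hlt
  obtain ⟨g, w, hg, hw, hgw, hmax⟩ := exists_isLocalMax_sub_time
    (hU.add hψ.continuous.neg.continuousOn.upperSemicontinuousOn)
    (fun x => by simpa using hinit x) (by simpa using hfar) hz (by simpa using hlt)
  have hχ : ContDiff ℝ 1 fun w : E × ℝ => 0 + g w.2 := contDiff_separable contDiff_const hg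
  have key := hsub _ w ⟨trivial, hw⟩ (hψ.add hχ) (hmax.congr (Eventually.of_forall fun w => by
    simp only [Pi.neg_apply]; ring))
  rw [timeDeriv_add (hψ.differentiable one_ne_zero _) (hχ.differentiable one_ne_zero _),
    spaceGrad_add (hψ.differentiable one_ne_zero _) (hχ.differentiable one_ne_zero _),
    timeDeriv_separable (fun _ => 0) g, spaceGrad_separable (fun _ => 0) g, gradient_fun_const,
    add_zero] at key
  linarith [hsuper w hw]

theorem IsViscositySubOn.le_cone [ProperSpace E] {G : E → E → ℝ} {U : E × ℝ → ℝ} {c : E} {a K C : ℝ}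
    (hU : UpperSemicontinuousOn U (univ ×ˢ Ici 0)) (hsub : IsViscositySubOn G (univ ×ˢ Ioi 0) U)
    (hb : ∀ T, ∃ B, ∀ x, ∀ t ∈ Icc 0 T, U (x, t) ≤ B) (hK : 0 < K) (hC : 0 ≤ C)
    (hG : ∀ p, ‖p‖ ≤ K → ∀ x, -C ≤ G p x) (h0 : ∀ x, U (x, 0) ≤ a + K * smoothDist c x) (x : E)
    {t : ℝ} (ht : 0 ≤ t) : U (x, t) ≤ a + K * smoothDist c x + C * t := by
  have hf : ContDiff ℝ 1 fun y => a + K * smoothDist c y :=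
    contDiff_const.add (contDiff_const.mul (contDiff_smoothDist c))
  have hg : ContDiff ℝ 1 fun r : ℝ => C * r := contDiff_const.mul contDiff_id
  refine IsViscositySubOn.le_of_classical_supersolution (z := (x, t))
    (ψ := fun w => (a + K * smoothDist c w.1) + C * w.2) hU hsub (contDiff_separable hf hg)
    (fun z _ => ?_) (by simpa using h0) (fun T => ?_) ht
  · obtain ⟨e, he, hgrad⟩ := exists_hasGradientAt_smoothDist c z.1
    have hgrad' : HasGradientAt (fun y => a + K * smoothDist c y) (K • e) z.1 := by
      simpa using hasGradientAt_add (hasGradientAt_const z.1 a) (hasGradientAt_const_mul K hgrad)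
    rw [timeDeriv_separable (fun y => a + K * smoothDist c y) (fun r => C * r),
      spaceGrad_separable (fun y => a + K * smoothDist c y) (fun r => C * r),
      hgrad'.gradient, deriv_const_mul_id]
    have : ‖K • e‖ ≤ K := by
      rw [norm_smul, Real.norm_of_nonneg hK.le]
      exact mul_le_of_le_one_right hK.le he
    linarith [hG _ this z.1]
  · obtain ⟨B, hB⟩ := hb T
    refine ⟨(B - a) / K + 1 + ‖c‖, fun y s hs hy => ?_⟩
    have := le_mul_smoothDist (c := c) (x := y) (B := B - a) hK
      (by linarith [norm_sub_norm_le y c])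
    have := mul_nonneg hC hs.1
    linarith [hB y s hs]

theorem exists_forall_sub_lt_of_continuous {E : Type*} [NormedAddCommGroup E] [NormedSpace ℝ E]
    [ProperSpace E] {G : E → ℝ} (hG : Continuous G) (r : ℝ) {κ : ℝ} (hκ : 0 < κ) :
    ∃ β > (0 : ℝ), ∀ P e : E, ‖P‖ ≤ r → ‖e‖ ≤ 1 → G P - G (P + β • e) < κ := by
  obtain ⟨b, hb, hbG⟩ := Metric.uniformContinuousOn_iff.1
    ((isCompact_closedBall (0 : E) (r + 1)).uniformContinuousOn_of_continuous hG.continuousOn) κ hκ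
  refine ⟨min 1 (b / 2), by positivity, fun P e hP he => ?_⟩
  have hβe : ‖min 1 (b / 2) • e‖ ≤ min 1 (b / 2) := by
    rw [norm_smul, Real.norm_of_nonneg (by positivity)]
    exact mul_le_of_le_one_right (by positivity) he
  refine (le_abs_self _).trans_lt (hbG P ?_ _ ?_ ?_)
  · rw [mem_closedBall_zero_iff]
    linarith
  · rw [mem_closedBall_zero_iff]
    linarith [norm_add_le P (min 1 (b / 2) • e), min_le_left 1 (b / 2)]
  · rw [dist_self_add_right]
    linarith [min_le_right 1 (b / 2)]

theorem exists_slab_doubling {E : Type*} [NormedAddCommGroup E] [ProperSpace E]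
    {U W : E × ℝ → ℝ} {f : E → ℝ} {g : ℝ → ℝ} {x₁ : E} {T B R δ N m : ℝ}
    (hU : UpperSemicontinuousOn U (univ ×ˢ Ici 0)) (hW : UpperSemicontinuousOn W (univ ×ˢ Ici 0))
    (hB : ∀ x y, ∀ t ∈ Icc 0 (T + 1), ∀ s ∈ Icc 0 (T + 1), U (x, t) + W (y, s) ≤ B)
    (hinit : ∀ x y, ‖x - y‖ ≤ δ → ∀ t ∈ Icc 0 δ, ∀ s ∈ Icc 0 δ, U (x, t) + W (y, s) ≤ m)
    (hδ : 0 < δ) (hδ2 : δ < 1 / 2) (hN : 0 < N) (hNB : ∀ a, N * a ^ 2 ≤ B → |a| ≤ δ)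
    (hf : Continuous f) (hf0 : ∀ x, 0 ≤ f x) (hfR : ∀ x, R ≤ ‖x - x₁‖ → B ≤ f x) (hR : 0 ≤ R)
    (hg : Continuous g) (hg0 : ∀ t, 0 ≤ g t) (hgT : ∀ t, T + 1 / 2 ≤ t → B ≤ g t) (hT : 0 ≤ T)
    (hm : 0 ≤ m) (hval : m < U (x₁, T) + W (x₁, T) - (f x₁ + g T)) :
    ∃ x t y s, 0 < t ∧ 0 < s ∧ ‖x - y‖ ≤ δ ∧
      IsLocalMax (fun z => U z - ((f z.1 + N * ‖z.1 - y‖ ^ 2) + (g z.2 + N * ‖z.2 - s‖ ^ 2)))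
        (x, t) ∧
      IsLocalMax (fun w => W w - (N * ‖w.1 - x‖ ^ 2 + N * ‖w.2 - t‖ ^ 2)) (y, s) := by
  set I := Icc 0 (T + 1)
  have hTI : T ∈ I := ⟨hT, by linarith⟩
  have hslab : ∀ r, Metric.closedBall x₁ r ×ˢ I ⊆ univ ×ˢ Ici 0 := fun r z hz => ⟨trivial, hz.2.1⟩
  have hcompact : ∀ r, IsCompact (Metric.closedBall x₁ r ×ˢ I) := fun r =>
    (isCompact_closedBall x₁ r).prod isCompact_Icc
  obtain ⟨⟨x, t⟩, ⟨hx, ht⟩, ⟨y, s⟩, ⟨hy, hs⟩, hle, hmaxU, hmaxW⟩ := exists_isLocalMax_doubling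
    (D := fun z w => (f z.1 + N * ‖z.1 - w.1‖ ^ 2) + (g z.2 + N * ‖z.2 - w.2‖ ^ 2))
    (hcompact R) (hcompact (R + 1)) (hU.mono (hslab R)) (hW.mono (hslab (R + 1))) (by fun_prop)
    (x₁ := (x₁, T)) (y₁ := (x₁, T)) ⟨Metric.mem_closedBall_self hR, hTI⟩
    ⟨Metric.mem_closedBall_self (by linarith), hTI⟩
  simp only [sub_self, norm_zero] at hle hx hy ht hs
  have hxy0 : 0 ≤ N * ‖x - y‖ ^ 2 := by positivity
  have hts0 : 0 ≤ N * ‖t - s‖ ^ 2 := by positivity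
  have hUW := hB x y t ht s hs
  have hxy : ‖x - y‖ ≤ δ := (le_abs_self _).trans (hNB _ (by linarith [hf0 x, hg0 t]))
  obtain ⟨hts₁, hts₂⟩ := abs_le.1 ((le_abs_self _).trans (hNB ‖t - s‖ (by linarith [hf0 x, hg0 t])))
  have hinterior : ¬(t ≤ δ ∧ s ≤ δ) := fun h => by
    linarith [hinit x y hxy t ⟨ht.1, h.1⟩ s ⟨hs.1, h.2⟩, hf0 x, hg0 t]
  have ht0 : 0 < t := lt_of_le_of_ne ht.1 fun h => hinterior ⟨by linarith, by linarith⟩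
  have hs0 : 0 < s := lt_of_le_of_ne hs.1 fun h => hinterior ⟨by linarith, by linarith⟩
  have htT : t < T + 1 / 2 := by
    by_contra! h
    linarith [hgT t h, hf0 x]
  have hxR : dist x x₁ < R := by
    by_contra! h
    linarith [hfR x (dist_eq_norm x x₁ ▸ h), hg0 t]
  have hyR : dist y x₁ < R + 1 := by
    linarith [dist_triangle_left y x₁ x, dist_eq_norm x y]
  refine ⟨x, t, y, s, ht0, hs0, hxy, hmaxU (prod_mem_nhds
    (Metric.closedBall_mem_nhds_of_mem hxR) (Icc_mem_nhds ht0 (by linarith))), ?_⟩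
  filter_upwards [hmaxW (prod_mem_nhds (Metric.closedBall_mem_nhds_of_mem hyR)
    (Icc_mem_nhds hs0 (by linarith)))] with w hw
  simp only [norm_sub_rev x, norm_sub_rev t] at hw
  linarith

theorem IsViscositySubOn.exists_deriv_le_of_doubling [CompleteSpace E] {G : E → ℝ}
    {U W : E × ℝ → ℝ} (hUs : IsViscositySubOn (fun p _ => G p) (univ ×ˢ Ioi 0) U)
    (hWs : IsViscositySubOn (dualHam fun p _ => G p) (univ ×ˢ Ioi 0) W) {g : ℝ → ℝ}
    (hg : ContDiff ℝ 1 g) {x₁ x y : E} {β N t s : ℝ} (ht : 0 < t) (hs : 0 < s)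
    (hmaxU : IsLocalMax (fun z => U z -
      ((β * smoothDist x₁ z.1 + N * ‖z.1 - y‖ ^ 2) + (g z.2 + N * ‖z.2 - s‖ ^ 2))) (x, t))
    (hmaxW : IsLocalMax (fun w => W w - (N * ‖w.1 - x‖ ^ 2 + N * ‖w.2 - t‖ ^ 2)) (y, s)) :
    ∃ e : E, ‖e‖ ≤ 1 ∧
      deriv g t ≤ G ((2 * N) • (x - y)) - G ((2 * N) • (x - y) + β • e) := by
  obtain ⟨e, he, hgrad⟩ := exists_hasGradientAt_smoothDist x₁ x
  have keyU := hUs.deriv_add_le_zero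
    ((contDiff_const.mul (contDiff_smoothDist x₁)).add (contDiff_mul_norm_sub_sq N y))
    (hg.add (contDiff_mul_norm_sub_sq N s)) (z := (x, t)) ⟨trivial, ht⟩ hmaxU
  have keyW := hWs.deriv_add_le_zero (contDiff_mul_norm_sub_sq N x)
    (contDiff_mul_norm_sub_sq N t) (z := (y, s)) ⟨trivial, hs⟩ hmaxW
  simp only [dualHam] at keyW
  rw [(hasGradientAt_add (hasGradientAt_const_mul β hgrad)
      (hasGradientAt_mul_norm_sub_sq N y x)).gradient, add_comm (β • e),
    ((hg.differentiable one_ne_zero t).hasDerivAt.fun_add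
      (hasDerivAt_mul_norm_sub_sq N s t)).deriv] at keyU
  rw [(hasGradientAt_mul_norm_sub_sq N x y).gradient, ← smul_neg, neg_sub,
    (hasDerivAt_mul_norm_sub_sq N t s).deriv] at keyW
  exact ⟨e, he, by linarith⟩

/-- The doubled maximum sits at positive times thanks to the uniform initial layer `hinit`; the
penalization parameter `N` is fixed before the slope `β` of the spatial cutoff. -/
theorem IsViscositySubOn.add_le_zero [ProperSpace E] {G : E → ℝ} (hG : Continuous G)
    {U W : E × ℝ → ℝ}
    (hU : UpperSemicontinuousOn U (univ ×ˢ Ici 0)) (hW : UpperSemicontinuousOn W (univ ×ˢ Ici 0))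
    (hUs : IsViscositySubOn (fun p _ => G p) (univ ×ˢ Ioi 0) U)
    (hWs : IsViscositySubOn (dualHam fun p _ => G p) (univ ×ˢ Ioi 0) W)
    (hUb : ∀ T, ∃ B, ∀ x, ∀ t ∈ Icc 0 T, U (x, t) ≤ B)
    (hWb : ∀ T, ∃ B, ∀ x, ∀ t ∈ Icc 0 T, W (x, t) ≤ B)
    (hinit : ∀ η > 0, ∃ δ > 0, ∀ x y, ‖x - y‖ ≤ δ → ∀ t ∈ Icc 0 δ, ∀ s ∈ Icc 0 δ,
      U (x, t) + W (y, s) ≤ η)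
    (x₁ : E) {T : ℝ} (hT : 0 ≤ T) : U (x₁, T) + W (x₁, T) ≤ 0 := by
  by_contra! hσ
  set σ := U (x₁, T) + W (x₁, T)
  obtain ⟨B₁, hB₁⟩ := hUb (T + 1)
  obtain ⟨B₂, hB₂⟩ := hWb (T + 1)
  have hTI : T ∈ Icc 0 (T + 1) := ⟨hT, by linarith⟩
  have hB : 0 < B₁ + B₂ := by linarith [hB₁ x₁ T hTI, hB₂ x₁ T hTI]
  obtain ⟨δ₀, hδ₀, hδ₀σ⟩ := hinit (σ / 4) (by positivity)
  obtain ⟨δ, hδ, hδδ₀, hδ2⟩ : ∃ δ > 0, δ ≤ δ₀ ∧ δ < 1 / 2 :=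
    ⟨min δ₀ (1 / 4), by positivity, min_le_left _ _, by linarith [min_le_right δ₀ (1 / 4)]⟩
  obtain ⟨N, hN, hNB⟩ := exists_quadratic_penalty (B₁ + B₂) hδ
  obtain ⟨g, κ, hκ, hg, hg0, hgT, hgB, hgκ⟩ := exists_timePenalty T (B₁ + B₂) (half_pos hσ)
  obtain ⟨β, hβ, hGβ⟩ := exists_forall_sub_lt_of_continuous hG (2 * N * δ) hκ
  obtain ⟨x, t, y, s, ht, hs, hxy, hmaxU, hmaxW⟩ := exists_slab_doubling
    (m := σ / 4) (R := (B₁ + B₂) / β + 1) hU hW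
    (fun x y t ht s hs => add_le_add (hB₁ x t ht) (hB₂ y s hs))
    (fun x y hxy t ht s hs => hδ₀σ x y (hxy.trans hδδ₀) t ⟨ht.1, ht.2.trans hδδ₀⟩ s
      ⟨hs.1, hs.2.trans hδδ₀⟩) hδ hδ2 hN hNB
    (contDiff_const.mul (contDiff_smoothDist x₁)).continuous
    (fun x => mul_nonneg hβ.le (smoothDist_nonneg x₁ x)) (fun x => le_mul_smoothDist hβ)
    (by positivity) hg.continuous (fun t => (hg0 t).le) (fun t ht => (hgB t ht).le) hT
    (by positivity) (by rw [smoothDist_self, hgT]; linarith)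
  obtain ⟨e, he, hle⟩ := hUs.exists_deriv_le_of_doubling hWs hg ht hs hmaxU hmaxW
  have hP : ‖(2 * N) • (x - y)‖ ≤ 2 * N * δ := by
    rw [norm_smul, Real.norm_of_nonneg (by positivity)]
    gcongr
  linarith [hGβ _ e hP he, hgκ t ht.le]

end Comparison

section InitialGrowth

/-- `U` leaves the initial datum `u₀` upwards at rate at most `C η`, up to any error `η > 0`. This
is an initial layer estimate uniform in space; fixing `C` makes it uniform along a family. -/
def HasInitialGrowth {X : Type*} (u₀ : X → ℝ) (C : ℝ → NNReal) (U : X × ℝ → ℝ) : Prop :=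
  ∀ η > 0, ∀ x, ∀ t, 0 ≤ t → U (x, t) ≤ u₀ x + η + C η * t

theorem HasInitialGrowth.le_add_mul {X : Type*} {u₀ : X → ℝ} {C : ℝ → NNReal}
    {U : X × ℝ → ℝ} (h : HasInitialGrowth u₀ C U) {M : ℝ} (hM : ∀ x, u₀ x ≤ M) {T t : ℝ}
    (ht : t ∈ Icc 0 T) (x : X) : U (x, t) ≤ M + 1 + C 1 * T := by
  have := mul_le_mul_of_nonneg_left ht.2 (C 1).coe_nonneg
  linarith [h 1 one_pos x t ht.1, hM x]

variable {E : Type*} [NormedAddCommGroup E]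

theorem exists_abs_sub_le_add_mul_smoothDist {u₀ : E → ℝ} (hu₀ : UniformContinuous u₀)
    (hb : ∃ M, ∀ x, |u₀ x| ≤ M) {η : ℝ} (hη : 0 < η) :
    ∃ K > 0, ∀ c x, |u₀ x - u₀ c| ≤ η + K * smoothDist c x := by
  obtain ⟨M, hM⟩ := hb
  have hM0 : 0 ≤ M := (abs_nonneg _).trans (hM 0)
  obtain ⟨δ, hδ, hδη⟩ := Metric.uniformContinuous_iff.1 hu₀ η hη
  have hs : 0 < √(1 + δ ^ 2) - 1 := sub_pos.2 (Real.lt_sqrt_of_sq_lt (by nlinarith))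
  refine ⟨(2 * M + 1) / (√(1 + δ ^ 2) - 1), by positivity, fun c x => ?_⟩
  rcases lt_or_ge ‖x - c‖ δ with hxc | hxc
  · have := hδη (dist_eq_norm x c ▸ hxc)
    rw [Real.dist_eq] at this
    have := smoothDist_nonneg c x
    have : 0 ≤ (2 * M + 1) / (√(1 + δ ^ 2) - 1) * smoothDist c x := by positivity
    linarith
  · have hsmooth : √(1 + δ ^ 2) - 1 ≤ smoothDist c x := by
      unfold smoothDist
      gcongr
    calc |u₀ x - u₀ c| ≤ |u₀ x| + |u₀ c| := abs_sub _ _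
      _ ≤ η + (2 * M + 1) := by linarith [hM x, hM c]
      _ = η + (2 * M + 1) / (√(1 + δ ^ 2) - 1) * (√(1 + δ ^ 2) - 1) := by
        rw [div_mul_cancel₀ _ hs.ne']
      _ ≤ η + (2 * M + 1) / (√(1 + δ ^ 2) - 1) * smoothDist c x := by gcongr

theorem HasInitialGrowth.exists_add_le {u₀ : E → ℝ} (hu₀ : UniformContinuous u₀)
    {C C' : ℝ → NNReal} {U W : E × ℝ → ℝ} (hU : HasInitialGrowth u₀ C U)
    (hW : HasInitialGrowth (fun x => -u₀ x) C' W) {η : ℝ} (hη : 0 < η) :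
    ∃ δ > 0, ∀ x y, ‖x - y‖ ≤ δ → ∀ t ∈ Icc 0 δ, ∀ s ∈ Icc 0 δ, U (x, t) + W (y, s) ≤ η := by
  obtain ⟨b, hb, hbη⟩ := Metric.uniformContinuous_iff.1 hu₀ (η / 4) (by positivity)
  set L : ℝ := C (η / 4) + C' (η / 4) + 1
  have hL : 0 < L := by positivity
  refine ⟨min (b / 2) (η / 4 / L), by positivity, fun x y hxy t ht s hs => ?_⟩
  have hxyb : |u₀ x - u₀ y| < η / 4 := hbη (by
    rw [dist_eq_norm]
    linarith [min_le_left (b / 2) (η / 4 / L)])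
  have htL : ∀ r ∈ Icc 0 (min (b / 2) (η / 4 / L)), r ≤ η / 4 / L := fun r hr =>
    hr.2.trans (min_le_right _ _)
  have hrate : C (η / 4) * t + C' (η / 4) * s ≤ η / 4 := calc
    (C (η / 4) * t + C' (η / 4) * s : ℝ)
      ≤ C (η / 4) * (η / 4 / L) + C' (η / 4) * (η / 4 / L) := by
        gcongr
        exacts [htL t ht, htL s hs]
    _ ≤ L * (η / 4 / L) := by rw [← add_mul]; gcongr; exact le_add_of_nonneg_right zero_le_one
    _ = η / 4 := mul_div_cancel₀ _ hL.ne'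
  linarith [hU (η / 4) (by positivity) x t ht.1, hW (η / 4) (by positivity) y s hs.1,
    le_abs_self (u₀ x - u₀ y)]

theorem HasInitialGrowth.add_le_zero {E : Type*} [NormedAddCommGroup E] [InnerProductSpace ℝ E]
    [ProperSpace E] {G : E → ℝ} (hG : Continuous G) {u₀ : E → ℝ} (hu₀ : UniformContinuous u₀)
    (hb : ∃ M, ∀ x, |u₀ x| ≤ M) {C C' : ℝ → NNReal} {U W : E × ℝ → ℝ}
    (hUC : HasInitialGrowth u₀ C U) (hWC : HasInitialGrowth (fun x => -u₀ x) C' W)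
    (hU : UpperSemicontinuousOn U (univ ×ˢ Ici 0)) (hW : UpperSemicontinuousOn W (univ ×ˢ Ici 0))
    (hUs : IsViscositySubOn (fun p _ => G p) (univ ×ˢ Ioi 0) U)
    (hWs : IsViscositySubOn (dualHam fun p _ => G p) (univ ×ˢ Ioi 0) W)
    (x : E) {t : ℝ} (ht : 0 ≤ t) : U (x, t) + W (x, t) ≤ 0 := by
  obtain ⟨M, hM⟩ := hb
  exact hUs.add_le_zero hG hU hW hWs
    (fun _ => ⟨_, fun x _ ht => hUC.le_add_mul (fun y => (abs_le.1 (hM y)).2) ht x⟩)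
    (fun _ => ⟨_, fun x _ ht => hWC.le_add_mul (fun y => neg_le.1 (abs_le.1 (hM y)).1) ht x⟩)
    (fun η hη => hUC.exists_add_le hu₀ hWC hη) x ht

theorem IsCauchySolution.hasInitialGrowth {d : ℕ} {G : Rd d → Rd d → ℝ} {D : ℝ → ℝ}
    (hG : ∀ r p x, ‖p‖ ≤ r → |G p x| ≤ D r) {u₀ : Rd d → ℝ} {K : ℝ → ℝ} (hK : ∀ η > 0, 0 < K η)
    (hslope : ∀ η > 0, ∀ c x, u₀ x - u₀ c ≤ η + K η * smoothDist c x) {u : Rd d → ℝ → ℝ}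
    (hu : IsCauchySolution G u₀ u) :
    HasInitialGrowth u₀ (fun η => Real.nnabs (D (K η))) (fun z => u z.1 z.2) := by
  intro η hη c t ht
  have hb : ∀ T, ∃ B, ∀ x, ∀ t ∈ Icc 0 T, u x t ≤ B := fun T =>
    (hu.bounded T).imp fun B hB x t ht => (le_abs_self _).trans (hB x t ht)
  have hcone := hu.isViscositySubOn.le_cone (c := c) (a := u₀ c + η) (K := K η)
    (C := |D (K η)|) hu.continuousOn.upperSemicontinuousOn hb (hK η hη) (abs_nonneg _)
    (fun p hp x => (abs_le.1 ((hG _ p x hp).trans (le_abs_self _))).1)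
    (fun x => by simp only [hu.initial]; linarith [hslope η hη c x]) c ht
  simpa [smoothDist_self] using hcone

theorem abs_dualHam_le {X : Type*} {G : E → X → ℝ} {D : ℝ → ℝ}
    (hG : ∀ r p x, ‖p‖ ≤ r → |G p x| ≤ D r) (r : ℝ) (p : E) (x : X) (hp : ‖p‖ ≤ r) :
    |dualHam G p x| ≤ D r := by
  rw [dualHam, abs_neg]
  exact hG r (-p) x (by rwa [norm_neg])

theorem exists_hasInitialGrowth {d : ℕ} {u₀ : Rd d → ℝ} (hu₀ : UniformContinuous u₀)
    (hb : ∃ M, ∀ x, |u₀ x| ≤ M) (D : ℝ → ℝ) :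
    ∃ C : ℝ → NNReal, ∀ (G : Rd d → Rd d → ℝ) (u : Rd d → ℝ → ℝ),
      (∀ r p x, ‖p‖ ≤ r → |G p x| ≤ D r) → IsCauchySolution G u₀ u →
      HasInitialGrowth u₀ C (fun z => u z.1 z.2) ∧
      HasInitialGrowth (fun x => -u₀ x) C (fun z => -u z.1 z.2) := by
  choose! K hK hslope using fun η (hη : (0 : ℝ) < η) =>
    exists_abs_sub_le_add_mul_smoothDist hu₀ hb hη
  refine ⟨_, fun G u hG hu => ⟨hu.hasInitialGrowth hG hK fun η hη c x => ?_,
    hu.dual.hasInitialGrowth (abs_dualHam_le hG) hK fun η hη c x => ?_⟩⟩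
  · exact (le_abs_self _).trans (hslope η hη c x)
  · linarith [(abs_le.1 (hslope η hη c x)).1]

theorem IsCauchySolution.unique {d : ℕ} {G : Rd d → ℝ} (hG : Continuous G) {u₀ : Rd d → ℝ}
    (hu₀ : UniformContinuous u₀) (hb : ∃ M, ∀ x, |u₀ x| ≤ M) {w w' : Rd d → ℝ → ℝ}
    (hw : IsCauchySolution (fun p _ => G p) u₀ w) (hw' : IsCauchySolution (fun p _ => G p) u₀ w')
    (x : Rd d) {t : ℝ} (ht : 0 ≤ t) : w x t = w' x t := by
  choose D hD using fun r =>
    (isCompact_closedBall (0 : Rd d) r).exists_bound_of_continuousOn hG.continuousOn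
  have hGD : ∀ r p, Rd d → ‖p‖ ≤ r → |G p| ≤ D r := fun r p _ hp =>
    hD r p (mem_closedBall_zero_iff.2 hp)
  obtain ⟨C, hC⟩ := exists_hasInitialGrowth hu₀ hb D
  have le_of : ∀ v v' : Rd d → ℝ → ℝ, IsCauchySolution (fun p _ => G p) u₀ v →
      IsCauchySolution (fun p _ => G p) u₀ v' → v x t ≤ v' x t := fun v v' hv hv' => by
    have := (hC _ v hGD hv).1.add_le_zero hG hu₀ hb (hC _ v' hGD hv').2
      hv.continuousOn.upperSemicontinuousOn hv'.dual.continuousOn.upperSemicontinuousOn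
      hv.isViscositySubOn hv'.dual.isViscositySubOn x ht
    simpa using this
  exact le_antisymm (le_of w w' hw hw') (le_of w' w hw' hw)

end InitialGrowth

section AdmissibleHamiltonian

/-- The properties of a single realization of the random Hamiltonian on which homogenization
rests: `H(p, x)` is uniformly continuous and bounded for bounded `p`, and `|H|` is coercive in `p`
uniformly in `x`. -/
structure IsAdmissible {E : Type*} [SeminormedAddCommGroup E] (H : E → E → ℝ) : Prop where
  uniformContinuousOn (R : ℝ) :
    UniformContinuousOn (fun z : E × E => H z.1 z.2) (Metric.closedBall 0 R ×ˢ univ)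
  bounded (R : ℝ) : ∃ C, ∀ p x, ‖p‖ ≤ R → |H p x| ≤ C
  coercive (M : ℝ) : ∃ R, ∀ p x, R ≤ ‖p‖ → M < |H p x|

theorem IsAdmissible.dual {E : Type*} [SeminormedAddCommGroup E] {H : E → E → ℝ}
    (hH : IsAdmissible H) : IsAdmissible (dualHam H) where
  uniformContinuousOn R :=
    uniformContinuous_neg.comp_uniformContinuousOn ((hH.uniformContinuousOn R).comp
      ((uniformContinuous_neg.comp uniformContinuous_fst).prodMk
        uniformContinuous_snd).uniformContinuousOn fun z hz => by simpa using hz)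
  bounded R := by
    obtain ⟨C, hC⟩ := hH.bounded R
    exact ⟨C, fun p x hp => by simpa [dualHam] using hC (-p) x (by simpa using hp)⟩
  coercive M := by
    obtain ⟨R, hR⟩ := hH.coercive M
    exact ⟨R, fun p x hp => by simpa [dualHam] using hR (-p) x (by simpa using hp)⟩

theorem lt_neg_of_forall_lt_abs {X : Type*} [TopologicalSpace X] {s : Set X}
    (hs : IsPreconnected s) {F : X → ℝ} (hF : ContinuousOn F s) {M : ℝ} (hM : 0 ≤ M)
    (habs : ∀ z ∈ s, M < |F z|) {a b : X} (ha : a ∈ s) (hb : b ∈ s) (hFa : F a ≤ M) :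
    F b < -M := by
  have hFa' : F a < -M := (lt_abs.1 (habs a ha)).elim (fun h => absurd hFa h.not_ge) lt_neg.1
  refine (lt_abs.1 (habs b hb)).elim (fun h => ?_) lt_neg.1
  obtain ⟨z, hz, hz0⟩ := hs.intermediate_value ha hb hF
    (show (0 : ℝ) ∈ Icc (F a) (F b) from ⟨by linarith, by linarith⟩)
  have := habs z hz
  rw [hz0, abs_zero] at this
  linarith

/-- No a priori bound on the gradients `P`, `Q` is needed: beyond the radius where `|H| > M`
coercivity prevents `H` from changing sign, so it cannot pass from below `M` to above `-M`. -/
theorem IsAdmissible.exists_forall_le_add {E : Type*} [NormedAddCommGroup E] [NormedSpace ℝ E]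
    {H : E → E → ℝ} (hH : IsAdmissible H) (M : ℝ) {η : ℝ} (hη : 0 < η) :
    ∃ s > 0, ∀ P Q x y, ‖P - Q‖ ≤ s → ‖x - y‖ ≤ s → ∀ a b, |a| ≤ M ∨ |b| ≤ M →
      H P x ≤ a → b ≤ H Q y → b ≤ a + η := by
  obtain ⟨R, hR⟩ := hH.coercive M
  obtain ⟨b₀, hb₀, hunif⟩ :=
    Metric.uniformContinuousOn_iff.1 (hH.uniformContinuousOn (R + 2)) η hη
  obtain ⟨s, hs, hs1, hsb⟩ : ∃ s > 0, s ≤ 1 ∧ s < b₀ :=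
    ⟨min 1 (b₀ / 2), by positivity, min_le_left _ _, by linarith [min_le_right 1 (b₀ / 2)]⟩
  refine ⟨s, hs, fun P Q x y hPQ hxy a b hab ha hb => ?_⟩
  have hQP : Q ∈ Metric.closedBall P s := by rwa [Metric.mem_closedBall, dist_eq_norm']
  by_contra! hlt
  obtain ⟨hM, haM, hbM⟩ : 0 ≤ M ∧ a ≤ M ∧ -M ≤ b := by
    rcases hab with h | h <;>
      exact ⟨(abs_nonneg _).trans h, by linarith [abs_le.1 h], by linarith [abs_le.1 h]⟩
  rcases le_total ‖P‖ (R + 1) with hP | hP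
  · have hQ : ‖Q‖ ≤ R + 2 := by linarith [norm_le_of_mem_closedBall hQP]
    have hclose : dist (P, x) (Q, y) < b₀ :=
      (max_le ((dist_eq_norm P Q).trans_le hPQ) ((dist_eq_norm x y).trans_le hxy)).trans_lt hsb
    have := hunif (P, x) ⟨mem_closedBall_zero_iff.2 (by linarith), trivial⟩ (Q, y)
      ⟨mem_closedBall_zero_iff.2 hQ, trivial⟩ hclose
    rw [Real.dist_eq, abs_lt] at this
    linarith
  · have hsub : Metric.closedBall P s ×ˢ (univ : Set E) ⊆
        Metric.closedBall 0 (‖P‖ + s) ×ˢ univ := fun z hz =>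
      ⟨mem_closedBall_zero_iff.2 (norm_le_of_mem_closedBall hz.1), trivial⟩
    have hlarge : ∀ z ∈ Metric.closedBall P s ×ˢ (univ : Set E), M < |H z.1 z.2| := fun z hz =>
      hR z.1 z.2 (by linarith [norm_sub_norm_le P z.1, mem_closedBall_iff_norm'.1 hz.1])
    have := lt_neg_of_forall_lt_abs ((convex_closedBall P s).prod convex_univ).isPreconnected
      ((hH.uniformContinuousOn _).continuousOn.mono hsub) hM hlarge (a := (P, x)) (b := (Q, y))
      ⟨Metric.mem_closedBall_self hs.le, trivial⟩ ⟨hQP, trivial⟩ (ha.trans haM)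
    linarith

end AdmissibleHamiltonian

section Homogenization

variable {d : ℕ}

theorem IsAuxiliarySolution.rescale_sub {H : Rd d → Rd d → ℝ} {ε : ℝ} (hε : 0 < ε) {p : Rd d}
    {v : Rd d → ℝ} (hv : IsAuxiliarySolution H ε p v) {φ : Rd d → ℝ} {x : Rd d}
    (hφ : ContDiff ℝ 1 φ) (hmax : IsLocalMax (fun y => ε * v (ε⁻¹ • y) - φ y) x) :
    ε * v (ε⁻¹ • x) + H (p + gradient φ x) (ε⁻¹ • x) ≤ 0 := by
  have hx : ε • ε⁻¹ • x = x := smul_inv_smul₀ hε.ne' x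
  have hχ : ContDiff ℝ 1 fun y => ε⁻¹ * φ (ε • y) := by fun_prop
  have hgrad : HasGradientAt (fun y => ε⁻¹ * φ (ε • y)) (gradient φ x) (ε⁻¹ • x) := by
    have hφx : HasGradientAt φ (gradient φ x) (ε • ε⁻¹ • x) := by
      rw [hx]
      exact (hφ.differentiable one_ne_zero x).hasGradientAt
    simpa only [inv_smul_smul₀ hε.ne'] using
      hasGradientAt_const_mul ε⁻¹ (hasGradientAt_comp_smul ε (ε⁻¹ • x) hφx)
  have hscale : Tendsto (fun y : Rd d => ε • y) (𝓝 (ε⁻¹ • x)) (𝓝 x) :=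
    (continuous_const_smul ε).tendsto' _ _ hx
  have hmax' : IsLocalMax (fun y => v y - ε⁻¹ * φ (ε • y)) (ε⁻¹ • x) := by
    filter_upwards [hscale.eventually hmax] with y hy
    rw [inv_smul_smul₀ hε.ne'] at hy
    refine le_of_mul_le_mul_left ?_ hε
    simpa only [mul_sub, mul_inv_cancel_left₀ hε.ne', hx] using hy
  simpa only [hgrad.gradient] using hv.sub _ _ hχ hmax'

theorem IsAuxiliarySolution.rescale {H : Rd d → Rd d → ℝ} {ε : ℝ} (hε : 0 < ε) {p : Rd d}
    {v : Rd d → ℝ} (hv : IsAuxiliarySolution H ε p v) :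
    IsAuxiliarySolution (fun p x => H p (ε⁻¹ • x)) 1 p (fun x => ε * v (ε⁻¹ • x)) where
  continuous := continuous_const.mul (hv.continuous.comp (continuous_const_smul _))
  bounded := by
    obtain ⟨C, hC⟩ := hv.bounded
    refine ⟨ε * C, fun x => ?_⟩
    rw [abs_mul, abs_of_pos hε]
    gcongr
    exact hC _
  sub φ x hφ hmax := by simpa only [one_mul] using hv.rescale_sub hε hφ hmax
  super φ x hφ hmin := by
    have := hv.dual.rescale_sub hε hφ.neg (x := x) (hmin.neg.congr (Eventually.of_forall fun y => by
      simp only; ring))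
    rw [gradient_neg, dualHam, neg_add, neg_neg, neg_neg] at this
    linarith

/-- A single realization of the conclusion of regular homogenizability at the slope `p`, for the
rescaled correctors `V ε x = ε v_ε(x / ε)`, where `v_ε` solves the auxiliary problem with discount
`λ = ε`. -/
def HomogenizesAt (H : Rd d → Rd d → ℝ) (p : Rd d) (h : ℝ) : Prop :=
  ∃ V : ℝ → Rd d → ℝ,
    (∀ ε > 0, IsAuxiliarySolution (fun p x => H p (ε⁻¹ • x)) 1 p (V ε)) ∧
    TendstoLocallyUniformly V (fun _ => -h) (𝓝[>] 0)

theorem homogenizesAt_of_auxiliary {H : Rd d → Rd d → ℝ} {p : Rd d} {h : ℝ} {v : ℝ → Rd d → ℝ}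
    (hv : ∀ l > 0, IsAuxiliarySolution H l p (v l))
    (hlim : ∀ R > 0, ∀ δ > 0, ∀ᶠ l in 𝓝[>] (0 : ℝ), ∀ x, ‖x‖ ≤ R / l → |l * v l x + h| ≤ δ) :
    HomogenizesAt H p h := by
  refine ⟨fun ε x => ε * v ε (ε⁻¹ • x), fun ε hε => (hv ε hε).rescale hε, ?_⟩
  refine Metric.tendstoLocallyUniformly_iff.2 fun δ hδ x =>
    ⟨Metric.ball 0 (‖x‖ + 1), Metric.isOpen_ball.mem_nhds (by simp), ?_⟩
  filter_upwards [hlim (‖x‖ + 1) (by positivity) (δ / 2) (by positivity),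
    eventually_mem_nhdsWithin] with ε hε hε0 y hy
  have hbound : ‖ε⁻¹ • y‖ ≤ (‖x‖ + 1) / ε := by
    rw [norm_smul, norm_inv, Real.norm_of_nonneg (le_of_lt hε0), inv_mul_eq_div]
    exact div_le_div_of_nonneg_right (mem_ball_zero_iff.1 hy).le (le_of_lt hε0)
  rw [dist_comm, Real.dist_eq, sub_neg_eq_add]
  linarith [hε _ hbound]

theorem HomogenizesAt.dual {H : Rd d → Rd d → ℝ} {p : Rd d} {h : ℝ} (hp : HomogenizesAt H p h) :
    HomogenizesAt (dualHam H) (-p) (-h) := by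
  obtain ⟨V, hV, hlim⟩ := hp
  exact ⟨fun ε x => -V ε x, fun ε hε => (hV ε hε).dual, hlim.neg⟩

end Homogenization

section PerturbedTestFunction

variable {d : ℕ}

theorem IsAuxiliarySolution.le_of_isLocalMin {G : Rd d → Rd d → ℝ} {l : ℝ} {q : Rd d}
    {V : Rd d → ℝ} (hV : IsAuxiliarySolution G l q V) {N : ℝ} {x y : Rd d}
    (hmin : IsLocalMin (fun w => V w + N * ‖w - x‖ ^ 2) y) :
    -(l * V y) ≤ G (q + (2 * N) • (x - y)) y := by
  have key := hV.super _ y (contDiff_mul_norm_sub_sq (-N) x)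
    (hmin.congr (Eventually.of_forall fun w => by simp only; ring))
  have hgrad : (2 * -N) • (y - x) = (2 * N) • (x - y) := by
    rw [mul_neg, neg_smul, ← smul_neg, neg_sub]
  rw [(hasGradientAt_mul_norm_sub_sq (-N) x y).gradient, hgrad] at key
  linarith

/-- Evans' perturbed test function method. Doubling only the space variable of
`u z - φ z - V y` removes the need for `V` to be differentiable; the price is the common
uncontrolled gradient `Q` of the penalization. -/
theorem IsViscositySubOn.exists_perturbed_test {G : Rd d → Rd d → ℝ} {z₀ z₁ : Rd d × ℝ}
    {r h δ gap c tol : ℝ} {u : Rd d × ℝ → ℝ} (hu : IsViscositySubOn G (Metric.ball z₀ r) u)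
    (hu_usc : UpperSemicontinuousOn u (Metric.closedBall z₀ r)) {q : Rd d} {V : Rd d → ℝ}
    (hV : IsAuxiliarySolution G 1 q V)
    (hVh : ∀ y ∈ Metric.closedBall z₀.1 (2 * r), |V y + h| ≤ δ) {φ : Rd d × ℝ → ℝ}
    (hφ : ContDiff ℝ 1 φ) (hgap : 2 * δ < gap)
    (hsph : ∀ z ∈ Metric.sphere z₀ r, u z - φ z ≤ c - gap) (hz₁ : z₁ ∈ Metric.ball z₀ r)
    (hcen : c ≤ u z₁ - φ z₁) (htol : 0 < tol) :
    ∃ z ∈ Metric.ball z₀ r, ∃ y Q, ‖z.1 - y‖ ≤ tol ∧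
      timeDeriv φ z + G (spaceGrad φ z + Q) z.1 ≤ 0 ∧ h - δ ≤ G (q + Q) y := by
  have husc : UpperSemicontinuousOn (fun z => u z + -φ z) (Metric.closedBall z₀ r) :=
    hu_usc.add hφ.continuous.neg.continuousOn.upperSemicontinuousOn
  obtain ⟨N, z, hz, y, hy, hzy, hmax, hmin⟩ := exists_isLocalMax_isLocalMin_doubling
    LipschitzWith.prod_fst husc hV.continuous.continuousOn
    (fun y hy y' hy' => by linarith [abs_le.1 (hVh y hy), abs_le.1 (hVh y' hy')])
    hsph hz₁ hcen htol
  refine ⟨z, hz, y, (2 * N) • (z.1 - y), hzy, ?_, ?_⟩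
  · have hN := contDiff_mul_norm_sub_sq N y
    have hχ := contDiff_separable hN (contDiff_const (c := (0 : ℝ)))
    have key := hu _ z hz (hφ.add hχ) (hmax.congr (Eventually.of_forall fun w => by
      simp only; ring))
    have hdφ := hφ.differentiable one_ne_zero z
    have hdχ := hχ.differentiable one_ne_zero z
    rwa [timeDeriv_add hdφ hdχ, spaceGrad_add hdφ hdχ,
      timeDeriv_separable (fun x => N * ‖x - y‖ ^ 2) (fun _ => 0), deriv_const, add_zero,
      spaceGrad_separable (fun x => N * ‖x - y‖ ^ 2) (fun _ => 0),
      (hasGradientAt_mul_norm_sub_sq N y z.1).gradient] at key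
  · linarith [hV.le_of_isLocalMin hmin, abs_le.1 (hVh y (Metric.ball_subset_closedBall hy))]

theorem IsAuxiliarySolution.exists_doubling {G : Rd d → Rd d → ℝ} {p q : Rd d} {h k κ δ tol : ℝ}
    {V W : Rd d → ℝ} (hV : IsAuxiliarySolution G 1 p V) (hW : IsAuxiliarySolution G 1 q W)
    (hVh : ∀ x ∈ Metric.closedBall 0 2, |V x + h| ≤ δ)
    (hWk : ∀ x ∈ Metric.closedBall 0 2, |W x + k| ≤ δ) (hδ : 4 * δ < κ) (htol : 0 < tol) :
    ∃ x ∈ Metric.ball (0 : Rd d) 1, ∃ y Q, ‖x - y‖ ≤ tol ∧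
      G (p + ((2 * κ) • x + Q)) x ≤ -V x ∧ k - δ ≤ G (q + Q) y := by
  have hκ := contDiff_mul_norm_sub_sq κ (0 : Rd d)
  have hball : ∀ x ∈ Metric.closedBall (0 : Rd d) 1, |V x + h| ≤ δ := fun x hx =>
    hVh x (Metric.closedBall_subset_closedBall one_le_two hx)
  obtain ⟨N, x, hx, y, hy, hxy, hmax, hmin⟩ := exists_isLocalMax_isLocalMin_doubling
    (f := fun x => V x - κ * ‖x - 0‖ ^ 2) (g := W) (z₀ := 0) (z₁ := 0) (r := 1) (c := -h - δ)
    (gap := κ - 2 * δ) LipschitzWith.id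
    (hV.continuous.sub hκ.continuous).continuousOn.upperSemicontinuousOn hW.continuous.continuousOn
    (fun y hy y' hy' => by
      rw [id, mul_one] at hy hy'
      linarith [abs_le.1 (hWk y hy), abs_le.1 (hWk y' hy')])
    (fun x hx => by
      rw [← dist_eq_norm, Metric.mem_sphere.1 hx]
      linarith [abs_le.1 (hball x (Metric.sphere_subset_closedBall hx))])
    (Metric.mem_ball_self one_pos)
    (by
      rw [sub_zero, norm_zero]
      linarith [abs_le.1 (hball 0 (Metric.mem_closedBall_self one_pos.le))]) htol
  rw [id, mul_one] at hy
  refine ⟨x, hx, y, (2 * N) • (x - y), hxy, ?_, ?_⟩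
  · have key := hV.sub _ x (hκ.add (contDiff_mul_norm_sub_sq N y))
      (hmax.congr (Eventually.of_forall fun w => by simp only [id]; ring))
    rw [(hasGradientAt_add (hasGradientAt_mul_norm_sub_sq κ 0 x)
      (hasGradientAt_mul_norm_sub_sq N y x)).gradient, sub_zero] at key
    linarith
  · linarith [hW.le_of_isLocalMin (x := x) hmin,
      abs_le.1 (hWk y (Metric.ball_subset_closedBall hy))]

theorem eventually_forall_abs_add_le {ι X : Type*} [TopologicalSpace X] {l : Filter ι}
    {V : ι → X → ℝ} {h δ : ℝ} (hV : TendstoLocallyUniformly V (fun _ => -h) l) {K : Set X}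
    (hK : IsCompact K) (hδ : 0 < δ) : ∀ᶠ i in l, ∀ x ∈ K, |V i x + h| ≤ δ := by
  have := (tendstoLocallyUniformlyOn_iff_tendstoUniformlyOn_of_compact hK).1
    hV.tendstoLocallyUniformlyOn
  filter_upwards [Metric.tendstoUniformlyOn_iff.1 this δ hδ] with i hi x hx
  simpa only [Real.dist_eq, sub_neg_eq_add, dist_comm (-h)] using (hi x hx).le

theorem norm_inv_smul_sub_le {E : Type*} [SeminormedAddCommGroup E] [NormedSpace ℝ E] {ε s : ℝ}
    (hε : 0 < ε) {x y : E} (hxy : ‖x - y‖ ≤ ε * s) : ‖ε⁻¹ • x - ε⁻¹ • y‖ ≤ s := by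
  rwa [← smul_sub, norm_smul, norm_inv, Real.norm_of_nonneg hε.le, inv_mul_le_iff₀ hε]

theorem IsAdmissible.exists_forall_homogenizesAt_le_add {H : Rd d → Rd d → ℝ}
    (hH : IsAdmissible H) (M : ℝ) {η : ℝ} (hη : 0 < η) :
    ∃ κ > 0, ∀ p q h k, HomogenizesAt H p h → HomogenizesAt H q k → ‖p - q‖ ≤ κ →
      |h| ≤ M ∨ |k| ≤ M → k ≤ h + η := by
  obtain ⟨s, hs, hclose⟩ := hH.exists_forall_le_add (M + η) (show 0 < η / 3 by positivity)
  refine ⟨s / 3, by positivity, ?_⟩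
  rintro p q h k ⟨V, hV, hVlim⟩ ⟨W, hW, hWlim⟩ hpq hM
  obtain ⟨δ, hδ, hδη, hδs⟩ : ∃ δ > 0, δ ≤ η / 3 ∧ 4 * δ < s / 3 :=
    ⟨min (η / 3) (s / 13), by positivity, min_le_left _ _,
      by linarith [min_le_right (η / 3) (s / 13)]⟩
  have hK := isCompact_closedBall (0 : Rd d) 2
  obtain ⟨ε, hVε, hWε, hε⟩ := ((eventually_forall_abs_add_le hVlim hK hδ).and
    ((eventually_forall_abs_add_le hWlim hK hδ).and self_mem_nhdsWithin)).exists
  obtain ⟨x, hx, y, Q, hxy, hx_le, hy_le⟩ :=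
    (hV ε hε).exists_doubling (hW ε hε) hVε hWε hδs (mul_pos hε hs)
  have hgrad : ‖p + ((2 * (s / 3)) • x + Q) - (q + Q)‖ ≤ s := by
    rw [show p + ((2 * (s / 3)) • x + Q) - (q + Q) = (p - q) + (2 * (s / 3)) • x by abel]
    refine (norm_add_le _ _).trans ?_
    rw [norm_smul, Real.norm_of_nonneg (by positivity)]
    nlinarith [mem_ball_zero_iff.1 hx]
  have hVx := abs_le.1 (hVε x (Metric.ball_subset_closedBall
    (Metric.ball_subset_ball one_le_two hx)))
  have := hclose _ _ _ _ hgrad (norm_inv_smul_sub_le hε hxy) _ (k - δ)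
    (hM.imp (fun hh => abs_le.2 ?_) fun hk => abs_le.2 ?_) hx_le hy_le
  · linarith
  · constructor <;> linarith [abs_le.1 hh]
  · constructor <;> linarith [abs_le.1 hk]

end PerturbedTestFunction

section RelaxedLimit

/-- `U` is, on `s`, the upper half-relaxed limit (`limsup*`) of the family `u` along `l`, that is
`U z = limsup u i w` as `i` tends to `l` and `w ∈ s` to `z`. It is encoded by the two halves of the
characterization of a real limsup, so that no junk value can occur. -/
structure IsUpperRelaxedLimit {ι X : Type*} [TopologicalSpace X] (l : Filter ι) (s : Set X)
    (u : ι → X → ℝ) (U : X → ℝ) : Prop where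
  eventually_lt : ∀ z ∈ s, ∀ c > U z, ∀ᶠ w in l ×ˢ 𝓝[s] z, u w.1 w.2 < c
  frequently_gt : ∀ z ∈ s, ∀ c < U z, ∃ᶠ w in l ×ˢ 𝓝[s] z, c < u w.1 w.2

variable {ι X : Type*} [TopologicalSpace X] {l : Filter ι} {s : Set X} {u : ι → X → ℝ}
  {U W : X → ℝ}

theorem exists_isUpperRelaxedLimit [l.NeBot]
    (hb : ∀ z ∈ s, ∃ B, ∀ᶠ w in l ×ˢ 𝓝[s] z, |u w.1 w.2| ≤ B) :
    ∃ U, IsUpperRelaxedLimit l s u U := by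
  refine ⟨fun z => limsup (fun w => u w.1 w.2) (l ×ˢ 𝓝[s] z), fun z hz c hc => ?_,
    fun z hz c hc => ?_⟩ <;> obtain ⟨B, hB⟩ := hb z hz
  · exact eventually_lt_of_limsup_lt hc
      (isBoundedUnder_of_eventually_le (hB.mono fun w hw => (abs_le.1 hw).2))
  · have := mem_closure_iff_nhdsWithin_neBot.1 (subset_closure hz)
    exact frequently_lt_of_lt_limsup (isBoundedUnder_of_eventually_ge
      (hB.mono fun w hw => (abs_le.1 hw).1)).isCoboundedUnder_le hc

namespace IsUpperRelaxedLimit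

theorem congr (h : IsUpperRelaxedLimit l s u U) (hUW : EqOn U W s) :
    IsUpperRelaxedLimit l s u W where
  eventually_lt z hz := hUW hz ▸ h.eventually_lt z hz
  frequently_gt z hz := hUW hz ▸ h.frequently_gt z hz

theorem upperSemicontinuousOn (h : IsUpperRelaxedLimit l s u U) : UpperSemicontinuousOn U s := by
  intro z hz c hc
  obtain ⟨c', hUc', hc'c⟩ := exists_between hc
  obtain ⟨p, hp, q, hq, hpq⟩ := eventually_prod_iff.1 (h.eventually_lt z hz c' hUc')
  filter_upwards [eventually_eventually_nhdsWithin.2 hq, self_mem_nhdsWithin] with w hw hws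
  by_contra! hcw
  obtain ⟨y, hy, hyp, hyq⟩ := ((h.frequently_gt w hws c' (hc'c.trans_le hcw)).and_eventually
    (hp.prod_mk hw)).exists
  exact (hpq hyp hyq).not_gt hy

theorem sub_continuousOn (h : IsUpperRelaxedLimit l s u U) {g : X → ℝ} (hg : ContinuousOn g s) :
    IsUpperRelaxedLimit l s (fun i z => u i z - g z) (fun z => U z - g z) where
  eventually_lt z hz c hc := by
    obtain ⟨b, hUb, hbc⟩ := exists_between (sub_lt_iff_lt_add.1 hc)
    filter_upwards [h.eventually_lt z hz b hUb, tendsto_snd.eventually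
      ((hg z hz).eventually_const_lt (sub_lt_iff_lt_add'.2 hbc))] with w hw hgw
    linarith
  frequently_gt z hz c hc := by
    obtain ⟨b, hcb, hbU⟩ := exists_between (lt_sub_iff_add_lt.1 hc)
    refine ((h.frequently_gt z hz b hbU).and_eventually (tendsto_snd.eventually
      ((hg z hz).eventually_lt_const (lt_sub_iff_add_lt'.2 hcb)))).mono fun w hw => ?_
    linarith [hw.1, hw.2]

theorem le_of_eventually_le (h : IsUpperRelaxedLimit l s u U) {g : X → ℝ} (hg : ContinuousOn g s)
    (hle : ∀ᶠ i in l, ∀ z ∈ s, u i z ≤ g z) {z : X} (hz : z ∈ s) : U z ≤ g z := by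
  by_contra! hlt
  obtain ⟨w, hw, hwle, hws⟩ := (((h.sub_continuousOn hg).frequently_gt z hz 0
    (sub_pos.2 hlt)).and_eventually (hle.prod_mk self_mem_nhdsWithin)).exists
  linarith [hwle w.2 hws]

theorem eventually_forall_lt (h : IsUpperRelaxedLimit l s u U) {K : Set X} (hK : IsCompact K)
    (hKs : K ⊆ s) {c : ℝ} (hc : ∀ z ∈ K, U z < c) : ∀ᶠ i in l, ∀ z ∈ K, u i z < c := by
  refine hK.induction_on (p := fun t => ∀ᶠ i in l, ∀ z ∈ t, u i z < c) (by simp)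
    (fun t t' htt' ht' => ht'.mono fun i hi z hz => hi z (htt' hz))
    (fun t t' ht ht' => (ht.and ht').mono fun i hi z hz => hz.elim (hi.1 z) (hi.2 z))
    fun z hz => ?_
  obtain ⟨p, hp, q, hq, hpq⟩ := eventually_prod_iff.1 (h.eventually_lt z (hKs hz) c (hc z hz))
  exact ⟨{w | q w}, nhdsWithin_mono z hKs hq, hp.mono fun i hi w hw => hpq hi hw⟩

theorem frequently_exists_gt (h : IsUpperRelaxedLimit l s u U) {z : X} (hz : z ∈ s) {t : Set X}
    (ht : t ∈ 𝓝[s] z) {c : ℝ} (hc : c < U z) : ∃ᶠ i in l, ∃ w ∈ t, c < u i w := by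
  intro hno
  refine h.frequently_gt z hz c hc ?_
  filter_upwards [hno.prod_mk ht] with w hw hcw
  exact hw.1 ⟨w.2, hw.2, hcw⟩

theorem add_nonneg [l.NeBot] (hU : IsUpperRelaxedLimit l s u U)
    (hW : IsUpperRelaxedLimit l s (fun i z => -u i z) W) {z : X} (hz : z ∈ s) :
    0 ≤ U z + W z := by
  by_contra! hlt
  have := mem_closure_iff_nhdsWithin_neBot.1 (subset_closure hz)
  obtain ⟨w, hUw, hWw⟩ := ((hU.eventually_lt z hz (U z - (U z + W z) / 2) (by linarith)).and
    (hW.eventually_lt z hz (W z - (U z + W z) / 2) (by linarith))).exists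
  linarith

theorem continuousOn (hU : IsUpperRelaxedLimit l s u U)
    (hU' : IsUpperRelaxedLimit l s (fun i z => -u i z) fun z => -U z) : ContinuousOn U s :=
  continuousOn_iff_lower_upperSemicontinuousOn.2
    ⟨fun z hz c hc => (hU'.upperSemicontinuousOn z hz (-c) (neg_lt_neg hc)).mono fun _ =>
      neg_lt_neg_iff.1, hU.upperSemicontinuousOn⟩

theorem tendstoLocallyUniformlyOn (hU : IsUpperRelaxedLimit l s u U)
    (hU' : IsUpperRelaxedLimit l s (fun i z => -u i z) fun z => -U z) :
    TendstoLocallyUniformlyOn u U l s := by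
  have hcont := hU.continuousOn hU'
  refine Metric.tendstoLocallyUniformlyOn_iff.2 fun η hη z hz => ?_
  have hclose : ∀ᶠ w in l ×ˢ 𝓝[s] z, dist (U w.2) (u w.1 w.2) < η := by
    filter_upwards [
      (hU.sub_continuousOn hcont).eventually_lt z hz η (by linarith),
      (hU'.sub_continuousOn hcont.neg).eventually_lt z hz η (by simpa using hη)] with w hw hw'
    rw [Real.dist_eq, abs_lt]
    constructor <;> simp only [Pi.neg_apply] at hw' <;> linarith
  obtain ⟨p, hp, q, hq, hpq⟩ := eventually_prod_iff.1 hclose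
  exact ⟨{w | q w}, hq, hp.mono fun i hi w hw => hpq hi hw⟩

end IsUpperRelaxedLimit

theorem IsUpperRelaxedLimit.frequently_strict_max {Y : Type*} [PseudoMetricSpace Y] [ProperSpace Y]
    {t : Set Y} {v : ι → Y → ℝ} {V : Y → ℝ} (hV : IsUpperRelaxedLimit l t v V) {φ : Y → ℝ}
    (hφ : ContinuousOn φ t) {z₀ : Y} {r : ℝ} (hr : 0 < r) (ht : Metric.closedBall z₀ r ⊆ t)
    (hmax : ∀ z ∈ Metric.closedBall z₀ r, V z - φ z + dist z z₀ ^ 2 ≤ V z₀ - φ z₀) :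
    ∃ᶠ i in l, ∃ c, (∀ z ∈ Metric.sphere z₀ r, v i z - φ z ≤ c - r ^ 2 / 2) ∧
      ∃ z ∈ Metric.ball z₀ r, c ≤ v i z - φ z := by
  have hVφ := hV.sub_continuousOn hφ
  have hr2 : 0 < r ^ 2 := by positivity
  set c := V z₀ - φ z₀ - r ^ 2 / 4 with hc
  have hsph : ∀ᶠ i in l, ∀ z ∈ Metric.sphere z₀ r, v i z - φ z < c - r ^ 2 / 2 :=
    hVφ.eventually_forall_lt (isCompact_sphere z₀ r) (Metric.sphere_subset_closedBall.trans ht)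
      fun z hz => by
        have := hmax z (Metric.sphere_subset_closedBall hz)
        rw [Metric.mem_sphere.1 hz] at this
        linarith
  have hcen : ∃ᶠ i in l, ∃ z ∈ Metric.ball z₀ r, c < v i z - φ z :=
    hVφ.frequently_exists_gt (ht (Metric.mem_closedBall_self hr.le))
      (mem_nhdsWithin_of_mem_nhds (Metric.ball_mem_nhds z₀ hr)) (by linarith)
  refine (hcen.and_eventually hsph).mono fun i hi => ⟨c, fun z hz => (hi.2 z hz).le, ?_⟩
  obtain ⟨z, hz, hcz⟩ := hi.1
  exact ⟨z, hz, hcz.le⟩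

end RelaxedLimit

section EffectiveSubsolution

variable {d : ℕ}

theorem IsAdmissible.exists_forall_timeDeriv_add_le {H : Rd d → Rd d → ℝ} (hH : IsAdmissible H)
    (M : ℝ) {η : ℝ} (hη : 0 < η) :
    ∃ s > 0, ∀ {ε : ℝ}, 0 < ε → ∀ {z₀ z₁ : Rd d × ℝ} {r h gap c : ℝ} {u φ : Rd d × ℝ → ℝ}
      {q : Rd d} {V : Rd d → ℝ},
      IsViscositySubOn (fun p x => H p (ε⁻¹ • x)) (Metric.ball z₀ r) u →
      UpperSemicontinuousOn u (Metric.closedBall z₀ r) →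
      IsAuxiliarySolution (fun p x => H p (ε⁻¹ • x)) 1 q V →
      (∀ y ∈ Metric.closedBall z₀.1 (2 * r), |V y + h| ≤ min η (gap / 3)) → 0 < gap →
      ContDiff ℝ 1 φ →
      (∀ z ∈ Metric.ball z₀ r, ‖spaceGrad φ z - q‖ ≤ s ∧ |timeDeriv φ z| ≤ M) →
      (∀ z ∈ Metric.sphere z₀ r, u z - φ z ≤ c - gap) → z₁ ∈ Metric.ball z₀ r →
      c ≤ u z₁ - φ z₁ → ∃ z ∈ Metric.ball z₀ r, timeDeriv φ z + h ≤ 2 * η := by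
  obtain ⟨s, hs, hclose⟩ := hH.exists_forall_le_add M hη
  refine ⟨s, hs, ?_⟩
  intro ε hε z₀ z₁ r h gap c u φ q V hu husc hV hVh hgap hφ hφs hsph hz₁ hcen
  obtain ⟨z, hz, y, Q, hzy, hle, hge⟩ := hu.exists_perturbed_test husc hV hVh hφ
    (by linarith [min_le_right η (gap / 3)]) hsph hz₁ hcen (mul_pos hε hs)
  have hgrad : ‖spaceGrad φ z + Q - (q + Q)‖ ≤ s := by
    rw [add_sub_add_right_eq_sub]
    exact (hφs z hz).1
  have := hclose _ _ _ _ hgrad (norm_inv_smul_sub_le hε hzy) (-timeDeriv φ z)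
    (h - min η (gap / 3)) (Or.inl ((abs_neg _).trans_le (hφs z hz).2)) (by linarith) hge
  exact ⟨z, hz, by linarith [min_le_left η (gap / 3)]⟩

theorem exists_homogenizing_slope_near {Hbar : Rd d → ℝ} (hbar : Continuous Hbar) {D : Set (Rd d)}
    (hD : Dense D) (p : Rd d) {s η : ℝ} (hs : 0 < s) (hη : 0 < η) :
    ∃ q ∈ D, ‖p - q‖ < s ∧ Hbar p < Hbar q + η := by
  have hopen : IsOpen {q | ‖p - q‖ < s ∧ Hbar p < Hbar q + η} :=
    (isOpen_lt (f := fun q => ‖p - q‖) (by fun_prop) continuous_const).and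
      (isOpen_lt continuous_const (g := fun q => Hbar q + η) (by fun_prop))
  obtain ⟨q, hq, hqD⟩ := hD.inter_open_nonempty _ hopen ⟨p, by simpa using hs, by linarith⟩
  exact ⟨q, hqD, hq⟩

theorem IsUpperRelaxedLimit.isViscositySubOn {H : Rd d → Rd d → ℝ} (hH : IsAdmissible H)
    {Hbar : Rd d → ℝ} (hbar : Continuous Hbar) {D : Set (Rd d)} (hD : Dense D)
    (hhom : ∀ p ∈ D, HomogenizesAt H p (Hbar p)) {u : ℝ → Rd d × ℝ → ℝ} {U : Rd d × ℝ → ℝ}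
    (husc : ∀ ε > 0, UpperSemicontinuousOn (u ε) (univ ×ˢ Ici 0))
    (hsub : ∀ ε > 0, IsViscositySubOn (fun p x => H p (ε⁻¹ • x)) (univ ×ˢ Ioi 0) (u ε))
    (hU : IsUpperRelaxedLimit (𝓝[>] 0) (univ ×ˢ Ici 0) u U) :
    IsViscositySubOn (fun p _ => Hbar p) (univ ×ˢ Ioi 0) U := by
  refine isViscositySubOn_of_strict fun φ z₀ hz₀ hφ hmax => ?_
  refine le_of_forall_pos_le_add fun η' hη' => ?_
  obtain ⟨η, hη, rfl⟩ : ∃ η > 0, 4 * η = η' := ⟨η' / 4, by positivity, by ring⟩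
  obtain ⟨s, hs, hpert⟩ := hH.exists_forall_timeDeriv_add_le (|timeDeriv φ z₀| + 1) hη
  obtain ⟨q, hqD, hqs, hqbar⟩ := exists_homogenizing_slope_near hbar hD (spaceGrad φ z₀) hs hη
  obtain ⟨V, hV, hVlim⟩ := hhom q hqD
  have hnear : ∀ᶠ z in 𝓝 z₀, (‖spaceGrad φ z - q‖ < s ∧ |timeDeriv φ z| < |timeDeriv φ z₀| + 1 ∧
      timeDeriv φ z₀ - η < timeDeriv φ z) ∧ 0 < z.2 ∧
      U z - φ z + dist z z₀ ^ 2 ≤ U z₀ - φ z₀ := by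
    have hgrad := (continuous_spaceGrad hφ).tendsto z₀
    have htime := (continuous_timeDeriv hφ).tendsto z₀
    exact ((((hgrad.sub_const q).norm).eventually_lt_const hqs).and
      ((htime.abs.eventually_lt_const (lt_add_one _)).and
        (htime.eventually_const_lt (sub_lt_self _ hη)))).and
      ((continuous_snd.tendsto z₀ |>.eventually_const_lt hz₀.2).and hmax)
  obtain ⟨r, hr, hball⟩ := Metric.nhds_basis_closedBall.eventually_iff.1 hnear
  have hpos : Metric.closedBall z₀ r ⊆ univ ×ˢ Ioi 0 := fun z hz => ⟨trivial, (hball hz).2.1⟩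
  have hnonneg : Metric.closedBall z₀ r ⊆ univ ×ˢ Ici 0 :=
    hpos.trans (prod_mono_right Ioi_subset_Ici_self)
  have hfreq := hU.frequently_strict_max hφ.continuous.continuousOn hr hnonneg
    fun z hz => (hball hz).2.2
  have hVclose := eventually_forall_abs_add_le hVlim (isCompact_closedBall z₀.1 (2 * r))
    (δ := min η (r ^ 2 / 2 / 3)) (by positivity)
  obtain ⟨ε, ⟨c, hsph, z₁, hz₁, hcen⟩, hVε, hε⟩ :=
    (hfreq.and_eventually (hVclose.and self_mem_nhdsWithin)).exists
  have hsubBall : IsViscositySubOn (fun p x => H p (ε⁻¹ • x)) (Metric.ball z₀ r) (u ε) :=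
    fun ψ z hz => hsub ε hε ψ z (hpos (Metric.ball_subset_closedBall hz))
  obtain ⟨z, hz, hle⟩ := hpert hε hsubBall ((husc ε hε).mono hnonneg) (hV ε hε) hVε
    (by positivity) hφ (fun z hz =>
      have hφz := (hball (Metric.ball_subset_closedBall hz)).1
      ⟨hφz.1.le, hφz.2.1.le⟩) hsph hz₁ hcen
  linarith [(hball (Metric.ball_subset_closedBall hz)).1.2.2]

end EffectiveSubsolution

section HomogenizedLimit

theorem HasInitialGrowth.abs_le {X : Type*} {u₀ : X → ℝ} {C : ℝ → NNReal} {U : X × ℝ → ℝ}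
    (hU : HasInitialGrowth u₀ C U) (hU' : HasInitialGrowth (fun x => -u₀ x) C fun z => -U z)
    {M : ℝ} (hM : ∀ x, |u₀ x| ≤ M) {T t : ℝ} (ht : t ∈ Icc 0 T) (x : X) :
    |U (x, t)| ≤ M + 1 + C 1 * T :=
  abs_le'.2 ⟨hU.le_add_mul (fun y => (abs_le'.1 (hM y)).1) ht x,
    hU'.le_add_mul (fun y => (abs_le'.1 (hM y)).2) ht x⟩

variable {d : ℕ}

theorem isCauchySolution_of_isViscositySubOn {G : Rd d → Rd d → ℝ} {u₀ : Rd d → ℝ}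
    (hb : ∃ M, ∀ x, |u₀ x| ≤ M) {C : ℝ → NNReal} {U : Rd d × ℝ → ℝ}
    (hcont : ContinuousOn U (univ ×ˢ Ici 0)) (hU : HasInitialGrowth u₀ C U)
    (hU' : HasInitialGrowth (fun x => -u₀ x) C fun z => -U z)
    (hsub : IsViscositySubOn G (univ ×ˢ Ioi 0) U)
    (hsuper : IsViscositySubOn (dualHam G) (univ ×ˢ Ioi 0) fun z => -U z) :
    IsCauchySolution G u₀ fun x t => U (x, t) where
  continuousOn := hcont
  bounded T := hb.imp' (fun M => M + 1 + C 1 * T) fun M hM x t ht => hU.abs_le hU' hM ht x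
  initial x := by
    refine le_antisymm (le_of_forall_pos_le_add fun η hη => ?_)
      (le_of_forall_pos_le_add fun η hη => ?_)
    · simpa using hU η hη x 0 le_rfl
    · linarith [hU' η hη x 0 le_rfl]
  sub φ x t ht hφ hmax := hsub φ (x, t) ⟨trivial, ht⟩ hφ hmax
  super φ x t ht hφ hmin := by
    have := hsuper (fun z => -φ z) (x, t) ⟨trivial, ht⟩ hφ.neg
      (hmin.neg.congr (Eventually.of_forall fun z => by simp only; ring))
    rw [timeDeriv, spaceGrad, deriv.fun_neg, gradient_neg, dualHam, neg_neg] at this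
    linarith

theorem exists_isUpperRelaxedLimit_isViscositySubOn {H : Rd d → Rd d → ℝ} (hH : IsAdmissible H)
    {Hbar : Rd d → ℝ} (hbar : Continuous Hbar) {D : Set (Rd d)} (hD : Dense D)
    (hhom : ∀ p ∈ D, HomogenizesAt H p (Hbar p)) {u₀ : Rd d → ℝ} (hu₀ : Continuous u₀)
    (hb : ∃ M, ∀ x, |u₀ x| ≤ M) {C : ℝ → NNReal} {u : ℝ → Rd d × ℝ → ℝ}
    (husc : ∀ ε > 0, UpperSemicontinuousOn (u ε) (univ ×ˢ Ici 0))
    (hsub : ∀ ε > 0, IsViscositySubOn (fun p x => H p (ε⁻¹ • x)) (univ ×ˢ Ioi 0) (u ε))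
    (hg : ∀ ε > 0, HasInitialGrowth u₀ C (u ε))
    (hg' : ∀ ε > 0, HasInitialGrowth (fun x => -u₀ x) C fun z => -u ε z) :
    ∃ U, IsUpperRelaxedLimit (𝓝[>] 0) (univ ×ˢ Ici 0) u U ∧ HasInitialGrowth u₀ C U ∧
      IsViscositySubOn (fun p _ => Hbar p) (univ ×ˢ Ioi 0) U := by
  obtain ⟨M, hM⟩ := hb
  obtain ⟨U, hU⟩ : ∃ U, IsUpperRelaxedLimit (𝓝[>] (0 : ℝ)) (univ ×ˢ Ici 0) u U := by
    refine exists_isUpperRelaxedLimit fun z hz => ⟨M + 1 + C 1 * (z.2 + 1), ?_⟩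
    have htime : ∀ᶠ w in 𝓝[univ ×ˢ Ici 0] z, w.2 ∈ Icc 0 (z.2 + 1) := by
      filter_upwards [self_mem_nhdsWithin, nhdsWithin_le_nhds
        ((continuous_snd.tendsto z).eventually_lt_const (lt_add_one z.2))] with w hw hwz
      exact ⟨hw.2, hwz.le⟩
    filter_upwards [prod_mem_prod self_mem_nhdsWithin htime] with w hw
    exact (hg w.1 hw.1).abs_le (hg' w.1 hw.1) hM hw.2 w.2.1
  refine ⟨U, hU, fun η hη x t ht => ?_, hU.isViscositySubOn hH hbar hD hhom husc hsub⟩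
  refine hU.le_of_eventually_le (g := fun z => u₀ z.1 + η + C η * z.2) (by fun_prop) ?_
    (mk_mem_prod trivial ht)
  filter_upwards [self_mem_nhdsWithin] with ε hε z hz
  exact hg ε hε η hη z.1 z.2 hz.2

theorem IsAdmissible.exists_homogenized_limit {H : Rd d → Rd d → ℝ} (hH : IsAdmissible H)
    {Hbar : Rd d → ℝ} (hbar : Continuous Hbar) {D : Set (Rd d)} (hD : Dense D)
    (hhom : ∀ p ∈ D, HomogenizesAt H p (Hbar p)) {u₀ : Rd d → ℝ} (hu₀ : UniformContinuous u₀)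
    (hb : ∃ M, ∀ x, |u₀ x| ≤ M) {u : ℝ → Rd d → ℝ → ℝ}
    (hu : ∀ ε > 0, IsCauchySolution (fun p x => H p (ε⁻¹ • x)) u₀ (u ε)) :
    ∃ ubar : Rd d → ℝ → ℝ, IsCauchySolution (fun p _ => Hbar p) u₀ ubar ∧
      TendstoLocallyUniformlyOn (fun (ε : ℝ) (z : Rd d × ℝ) => u ε z.1 z.2)
        (fun z => ubar z.1 z.2) (𝓝[>] 0) (univ ×ˢ Ioi 0) := by
  choose B hB using hH.bounded
  obtain ⟨C, hC⟩ := exists_hasInitialGrowth hu₀ hb B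
  have hg := fun ε hε => hC _ _ (fun r p x hp => hB r p _ hp) (hu ε hε)
  have hD' : Dense (-D) := hD.preimage (Homeomorph.neg (Rd d)).isOpenMap
  have hhom' : ∀ p ∈ -D, HomogenizesAt (dualHam H) p (-Hbar (-p)) := fun p hp => by
    simpa only [neg_neg] using (hhom (-p) hp).dual
  obtain ⟨U, hU, hUg, hUs⟩ := exists_isUpperRelaxedLimit_isViscositySubOn hH hbar hD hhom
    hu₀.continuous hb (fun ε hε => (hu ε hε).continuousOn.upperSemicontinuousOn)
    (fun ε hε => (hu ε hε).isViscositySubOn) (fun ε hε => (hg ε hε).1) (fun ε hε => (hg ε hε).2)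
  obtain ⟨W, hW, hWg, hWs⟩ := exists_isUpperRelaxedLimit_isViscositySubOn hH.dual
    (hbar.comp continuous_neg).neg hD' hhom' (u₀ := fun x => -u₀ x) hu₀.continuous.neg
    (by simpa only [abs_neg] using hb)
    (fun ε hε => (hu ε hε).dual.continuousOn.upperSemicontinuousOn)
    (fun ε hε => (hu ε hε).dual.isViscositySubOn) (fun ε hε => (hg ε hε).2)
    (fun ε hε => by simpa only [neg_neg] using (hg ε hε).1)
  have hWU : ∀ z ∈ univ ×ˢ Ici (0 : ℝ), W z = -U z := fun z hz => by
    have hle := hUg.add_le_zero hbar hu₀ hb hWg hU.upperSemicontinuousOn hW.upperSemicontinuousOn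
      hUs hWs z.1 hz.2
    linarith [hU.add_nonneg hW hz]
  have hU' := hW.congr hWU
  have hUg' : HasInitialGrowth (fun x => -u₀ x) C fun z => -U z := fun η hη x t ht =>
    (hWU (x, t) ⟨trivial, ht⟩).symm.trans_le (hWg η hη x t ht)
  have hUs' := hU'.isViscositySubOn hH.dual (hbar.comp continuous_neg).neg hD' hhom'
    (fun ε hε => (hu ε hε).dual.continuousOn.upperSemicontinuousOn)
    (fun ε hε => (hu ε hε).dual.isViscositySubOn)
  exact ⟨fun x t => U (x, t),
    isCauchySolution_of_isViscositySubOn hb (hU.continuousOn hU') hUg hUg' hUs hUs',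
    (hU.tendstoLocallyUniformlyOn hU').mono (prod_mono_right Ioi_subset_Ici_self)⟩

end HomogenizedLimit

section Probability

theorem forall_le_abs_of_dense_of_ae {E X : Type*} [NormedAddCommGroup E] [TopologicalSpace X]
    [MeasurableSpace X] {ν : Measure X} [ν.IsOpenPosMeasure] {H : E → X → ℝ}
    (hH : Continuous fun z : E × X => H z.1 z.2) {D : Set E} (hD : Dense D) {M R : ℝ}
    (h : ∀ p ∈ D, R < ‖p‖ → ∀ᵐ x ∂ν, M ≤ |H p x|) {p : E} (hp : R < ‖p‖) (x : X) :
    M ≤ |H p x| := by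
  have hclosed : IsClosed {z : E × X | M ≤ |H z.1 z.2|} := isClosed_le continuous_const hH.abs
  have hslope : {q | R < ‖q‖} ∩ D ⊆ {q | M ≤ |H q x|} := fun q ⟨hqR, hqD⟩ => by
    have hclosed_q := hclosed.preimage (Continuous.prodMk_right q)
    exact hclosed_q.closure_subset_iff.2 subset_rfl (Measure.dense_of_ae (h q hqD hqR) x)
  exact closure_minimal hslope (hclosed.preimage (Continuous.prodMk_left x))
    (hD.open_subset_closure_inter (isOpen_lt continuous_const continuous_norm) hp)

variable {d : ℕ} {Ω : Type*} {H : Rd d → Rd d → Ω → ℝ}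

theorem IsContinuousBounded.uniformContinuousOn (hA3 : IsContinuousBounded H) (ω : Ω) (R : ℝ) :
    UniformContinuousOn (fun z : Rd d × Rd d => H z.1 z.2 ω)
      (Metric.closedBall 0 R ×ˢ univ) := by
  obtain ⟨ρ, hρ, hle⟩ := hA3.1 ω _ (isCompact_closedBall (0 : Rd d) R)
  refine Metric.uniformContinuousOn_iff_le.2 fun η hη => ?_
  obtain ⟨b, hb, hbρ⟩ := mem_nhdsGT_iff_exists_Ioo_subset.1 (hρ.tendsto.eventually_lt_const hη)
  have hb : 0 < b := hb
  refine ⟨b / 3, by positivity, fun z hz w hw hzw => (hle _ hz.1 _ hw.1 _ _).trans ?_⟩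
  rw [dist_eq_norm] at hzw
  have hfst : ‖z.1 - w.1‖ ≤ b / 3 := (norm_fst_le (z - w)).trans hzw
  have hsnd : ‖z.2 - w.2‖ ≤ b / 3 := (norm_snd_le (z - w)).trans hzw
  rcases (by positivity : 0 ≤ ‖z.1 - w.1‖ + ‖z.2 - w.2‖).eq_or_lt with h | h
  · rw [← h, hρ.zero]
    exact hη.le
  · exact le_of_lt (hbρ ⟨h, by linarith⟩)

variable [MeasurableSpace Ω] {μ : Measure Ω}

theorem IsCoerciveHamiltonian.exists_forall_ae_lt_abs [SFinite μ]
    (hA2 : IsCoerciveHamiltonian μ H) (n : ℕ) :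
    ∃ R : ℝ, ∀ p, R < ‖p‖ → ∀ᵐ ω ∂μ, ∀ᵐ x, (n : ℝ) < |H p x ω| := by
  have hlt : (n : ENNReal) < liminf (fun p : Rd d =>
      essInf (fun z : Rd d × Ω => ENNReal.ofReal |H p z.1 z.2|)
        ((volume : Measure (Rd d)).prod μ)) (Bornology.cobounded (Rd d)) :=
    (ENNReal.natCast_lt_top n).trans_eq hA2.symm
  obtain ⟨R, -, hR⟩ := (hasBasis_cobounded_norm (E := Rd d)).eventually_iff.1
    (eventually_lt_of_lt_liminf hlt)
  refine ⟨R, fun p hp => Measure.ae_ae_of_ae_prod (p := fun z => (n : ℝ) < |H p z.2 z.1|) ?_⟩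
  filter_upwards [Measure.measurePreserving_swap.quasiMeasurePreserving.ae
    (ae_lt_of_lt_essInf (hR hp.le))] with z hz
  simpa using (ENNReal.lt_ofReal_iff_toReal_lt (ENNReal.natCast_ne_top n)).1 hz

theorem ae_isAdmissible [SFinite μ] (hA2 : IsCoerciveHamiltonian μ H)
    (hA3 : IsContinuousBounded H) : ∀ᵐ ω ∂μ, IsAdmissible fun p x => H p x ω := by
  choose R hR using hA2.exists_forall_ae_lt_abs
  have hdense : ∀ᵐ ω ∂μ, ∀ n i : ℕ, R n < ‖TopologicalSpace.denseSeq (Rd d) i‖ →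
      ∀ᵐ x, (n : ℝ) < |H (TopologicalSpace.denseSeq (Rd d) i) x ω| := by
    simp only [ae_all_iff]
    exact fun n i => hR n _
  filter_upwards [hdense] with ω hω
  refine ⟨hA3.uniformContinuousOn ω, fun r => ?_, fun M => ?_⟩
  · obtain ⟨C, hC⟩ := hA3.2 _ (isCompact_closedBall (0 : Rd d) r)
    exact ⟨C, fun p x hp => hC p (by simpa using hp) x ω⟩
  · have hcont : Continuous fun z : Rd d × Rd d => H z.1 z.2 ω :=
      continuous_iff_continuousAt.2 fun z =>
        (hA3.uniformContinuousOn ω (‖z.1‖ + 1)).continuousOn.continuousAt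
          (prod_mem_nhds (Metric.closedBall_mem_nhds_of_mem (by simp)) univ_mem)
    obtain ⟨n, hn⟩ := exists_nat_gt M
    refine ⟨R n + 1, fun p x hp => hn.trans_le ?_⟩
    refine forall_le_abs_of_dense_of_ae (ν := volume) (H := fun p x => H p x ω) hcont
      (TopologicalSpace.denseRange_denseSeq (Rd d)) ?_ (R := R n) (by linarith) x
    rintro _ ⟨i, rfl⟩ hi
    exact (hω n i hi).mono fun x hx => hx.le

theorem IsRegularlyHomogenizableAt.ae_homogenizesAt {p : Rd d} {h : ℝ}
    (hreg : IsRegularlyHomogenizableAt μ H p h) :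
    ∀ᵐ ω ∂μ, HomogenizesAt (fun p x => H p x ω) p h :=
  hreg.mono fun _ ⟨_, hv, hlim⟩ => homogenizesAt_of_auxiliary hv hlim

theorem continuous_of_isRegularlyHomogenizableAt [NeZero μ]
    (hH : ∀ᵐ ω ∂μ, IsAdmissible fun p x => H p x ω) {Hbar : Rd d → ℝ}
    (hreg : ∀ p, IsRegularlyHomogenizableAt μ H p (Hbar p)) : Continuous Hbar := by
  refine continuous_iff_continuousAt.2 fun p => tendsto_of_seq_tendsto fun q hq => ?_
  have hqn : ∀ᵐ ω ∂μ, ∀ n, HomogenizesAt (fun p x => H p x ω) (q n) (Hbar (q n)) :=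
    ae_all_iff.2 fun n => (hreg (q n)).ae_homogenizesAt
  obtain ⟨ω, hω, hωp, hωq⟩ := (hH.and ((hreg p).ae_homogenizesAt.and hqn)).exists
  refine Metric.tendsto_nhds.2 fun η hη => ?_
  obtain ⟨κ, hκ, hle⟩ := hω.exists_forall_homogenizesAt_le_add |Hbar p| (half_pos hη)
  filter_upwards [Metric.tendsto_nhds.1 hq κ hκ] with n hn
  rw [dist_eq_norm] at hn
  have hupper := hle p (q n) _ _ hωp (hωq n) (norm_sub_rev p (q n) ▸ hn.le) (Or.inl le_rfl)
  have hlower := hle (q n) p _ _ (hωq n) hωp hn.le (Or.inr le_rfl)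
  rw [Function.comp, Real.dist_eq, abs_lt]
  constructor <;> linarith

end Probability

theorem mainTheorem5_general {d : ℕ} {Ω : Type*} [MeasurableSpace Ω] (μ : Measure Ω)
    [IsProbabilityMeasure μ]
    (H : Rd d → Rd d → Ω → ℝ) (hH : ∀ᵐ ω ∂μ, IsAdmissible fun p x => H p x ω)
    (Hbar : Rd d → ℝ) (hreg : ∀ p, IsRegularlyHomogenizableAt μ H p (Hbar p))
    (u₀ : Rd d → ℝ) (hu₀ : UniformContinuous u₀) (hu₀b : ∃ C : ℝ, ∀ x, |u₀ x| ≤ C)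
    (u : ℝ → Ω → Rd d → ℝ → ℝ)
    (hu : ∀ᵐ ω ∂μ, ∀ ε > 0, IsCauchySolution (fun p x => H p (ε⁻¹ • x) ω) u₀ (u ε ω)) :
    ∃ (Ω' : Set Ω) (ubar : Rd d → ℝ → ℝ),
      MeasurableSet Ω' ∧ μ Ω' = 1 ∧
      (∀ ω ∈ Ω', TendstoLocallyUniformlyOn
        (fun (ε : ℝ) (z : Rd d × ℝ) => u ε ω z.1 z.2) (fun z => ubar z.1 z.2)
        (𝓝[>] 0) (univ ×ˢ Ioi 0)) ∧
      IsCauchySolution (fun p _ => Hbar p) u₀ ubar ∧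
      (∀ w : Rd d → ℝ → ℝ, IsCauchySolution (fun p _ => Hbar p) u₀ w →
        ∀ x, ∀ t ≥ 0, w x t = ubar x t) := by
  have hbar := continuous_of_isRegularlyHomogenizableAt hH hreg
  have hhom : ∀ᵐ ω ∂μ, ∀ p ∈ range (TopologicalSpace.denseSeq (Rd d)),
      HomogenizesAt (fun p x => H p x ω) p (Hbar p) := by
    simp only [forall_mem_range, ae_all_iff]
    exact fun n => (hreg _).ae_homogenizesAt
  have hlim : ∀ᵐ ω ∂μ, ∃ ubar : Rd d → ℝ → ℝ, IsCauchySolution (fun p _ => Hbar p) u₀ ubar ∧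
      TendstoLocallyUniformlyOn (fun (ε : ℝ) (z : Rd d × ℝ) => u ε ω z.1 z.2)
        (fun z => ubar z.1 z.2) (𝓝[>] 0) (univ ×ˢ Ioi 0) := by
    filter_upwards [hH, hhom, hu] with ω hHω hhomω huω
    exact hHω.exists_homogenized_limit hbar (TopologicalSpace.denseRange_denseSeq _) hhomω hu₀ hu₀b
      huω
  obtain ⟨Ω', hΩ', hmeas, hΩ'lim⟩ := hlim.exists_measurable_mem
  obtain ⟨-, ubar, hubar, -⟩ := hlim.exists
  have hunique : ∀ w, IsCauchySolution (fun p _ => Hbar p) u₀ w → ∀ x, ∀ t ≥ 0, w x t = ubar x t :=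
    fun w hw x t ht => hw.unique hbar hu₀ hu₀b hubar x ht
  refine ⟨Ω', ubar, hmeas, (mem_ae_iff_prob_eq_one hmeas).1 hΩ', fun ω hω => ?_, hubar, hunique⟩
  obtain ⟨w, hw, hwlim⟩ := hΩ'lim ω hω
  exact hwlim.congr_right fun z hz => hunique w hw z.1 z.2 (le_of_lt hz.2)

theorem mainTheorem5 {d : ℕ} {Ω : Type*} [MeasurableSpace Ω] (μ : Measure Ω)
    [IsProbabilityMeasure μ]
    (H : Rd d → Rd d → Ω → ℝ)
    (hA1 : IsStationaryErgodic μ H) (hA2 : IsCoerciveHamiltonian μ H) (hA3 : IsContinuousBounded H)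
    (Hbar : Rd d → ℝ) (hreg : ∀ p, IsRegularlyHomogenizableAt μ H p (Hbar p))
    (u₀ : Rd d → ℝ) (hu₀ : UniformContinuous u₀) (hu₀b : ∃ C : ℝ, ∀ x, |u₀ x| ≤ C)
    (u : ℝ → Ω → Rd d → ℝ → ℝ)
    (hu : ∀ᵐ ω ∂μ, ∀ ε > 0, IsCauchySolution (fun p x => H p (ε⁻¹ • x) ω) u₀ (u ε ω)) :
    ∃ (Ω' : Set Ω) (ubar : Rd d → ℝ → ℝ),
      MeasurableSet Ω' ∧ μ Ω' = 1 ∧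
      (∀ ω ∈ Ω', TendstoLocallyUniformlyOn
        (fun (ε : ℝ) (z : Rd d × ℝ) => u ε ω z.1 z.2) (fun z => ubar z.1 z.2)
        (𝓝[>] 0) (univ ×ˢ Ioi 0)) ∧
      IsCauchySolution (fun p _ => Hbar p) u₀ ubar ∧
      (∀ w : Rd d → ℝ → ℝ, IsCauchySolution (fun p _ => Hbar p) u₀ w →
        ∀ x, ∀ t ≥ 0, w x t = ubar x t) :=
  mainTheorem5_general μ H (ae_isAdmissible hA2 hA3) Hbar hreg u₀ hu₀ hu₀b u hu
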